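/- Let $n,r,k,t$ be positive integers with $n\ge r$ and $k\ge 2$. A $k$-signed $r$-set on $[n]=\{1,\dots,n\}$ is a set $\{(x_1,y_1),\dots,(x_r,y_r)\}$ with $x_1,\dots,x_r$ distinct elements of $[n]$ and $y_1,\dots,y_r\in[k]$; let $\mathcal L_{n,r,k}$ be the set of all of them. A family $\mathcal F\subseteq\mathcal L_{n,r,k}$ is $t$-intersecting if $|F\cap F'|\ge t$ for all $F,F'\in\mathcal F$, and trivial if all its members contain a fixed $k$-signed $t$-set. A maximal non-trivial $t$-intersecting family is one that is inclusion-maximal among the non-trivial $t$-intersecting subfamilies of $\mathcal L_{n,r,k}$. Two families $\mathcal F,\mathcal G\subseteq\mathcal L_{n,r,k}$ are isomorphic, $\mathcal F\cong\mathcal G$, if $\mathcal G=\{\sigma(F):F\in\mathcal F\}$ for some bijection $\sigma$ of $[n]\times[k]$ onto itself. Put $M_d=\{(1,1),(2,1),\dots,(d,1)\}$ for $d\in[n]$. For $t+1\le r\le n$ and $t+2\le\ell\le\min\{r+1,n\}$ let $\mathcal H_1(n,r,k,\ell,t)$ be the set of all $F\in\mathcal L_{n,r,k}$ such that either $M_t\subseteq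 F$ and $|F\cap M_\ell|\ge t+1$, or $M_t\not\subseteq F$ and $|F\cap M_\ell|=\ell-1$. For $t+2\le r\le n$ and $r+2\le c\le\min\{2r-t,n\}$ let $\mathcal H_2(n,r,k,c,t)$ be the set of all $F\in\mathcal L_{n,r,k}$ such that $M_t\subseteq F$ and $|F\cap M_r|\ge t+1$; or $F\cap M_r=M_t$ and $M_c\setminus M_r\subseteq F$; or $M_t\not\subseteq F$, $|F\cap M_r|=r-1$ and $|F\cap(M_c\setminus M_r)|=1$. Let $$f(n,r,k,d,t)=(d-t)\binom{n-t-1}{r-t-1}k^{r-t-1}-\binom{d-t}{2}\binom{n-t-2}{r-t-2}k^{r-t-2},$$ $$g(n,r,t)=\frac{(r-t+3)(r-t-1)}{n-t-1}\cdot\max\left\{\binom{t+2}{2},\frac{r-t+1}{2}\right\},$$ where a binomial coefficient with negative lower index is $0$. **Theorem.** Let $n,r,k,t$ be positive integers with $n\ge t+2$, $n\ge r\ge t+1$ and $k\ge\max\{2,g(n,r,t)\}$, and let $\mathcal F$ be a maximal non-trivial $t$-intersecting subfamily of $\mathcal L_{n,r,k}$. Then $|\mathcal F|\ge f(n,r,k,r,t)$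 if and only if one of the following holds: (i) $r\ge t+2$ and $\mathcal F\cong\mathcal H_1(n,r,k,m,t)$ for some $m\in\{r,\min\{r+1,n\}\}$; (ii) $n\ge r+2\ge t+4$ and $\mathcal F\cong\mathcal H_2(n,r,k,c,t)$ for some $c\in\{r+2,\dots,\min\{2r-t,n\}\}$; (iii) $r\le 2t+2$, $r\ne t+2$ and $\mathcal F\cong\mathcal H_1(n,r,k,t+2,t)$. -/

import Mathlib

namespace SignedSets

/-- The collection of all `k`-signed `r`-sets on `[n]`: sets of `r` pairs in `[n] × [k]` whose first
coordinates are distinct. The sets `[n]` and `[k]` are modelled by `Fin n` and `Fin k`, so that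
the element `i` of `[n]` corresponds to the element of `Fin n` with value `i - 1`. -/
def signedSets (n r k : ℕ) : Finset (Finset (Fin n × Fin k)) :=
  Finset.univ.filter fun F => F.card = r ∧ ∀ p ∈ F, ∀ q ∈ F, p.1 = q.1 → p = q

/-- `|F ∩ F'| ≥ t` for all members `F, F'`. -/
def IsTIntersecting {n k : ℕ} (t : ℕ) (𝓕 : Finset (Finset (Fin n × Fin k))) : Prop :=
  ∀ F ∈ 𝓕, ∀ F' ∈ 𝓕, t ≤ (F ∩ F').card

/-- All members contain a fixed `k`-signed `t`-set. -/
def IsTrivial {n k : ℕ} (t : ℕ) (𝓕 : Finset (Finset (Fin n × Fin k))) : Prop :=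
  ∃ T ∈ signedSets n t k, ∀ F ∈ 𝓕, T ⊆ F

/-- Non-trivial `t`-intersecting families of `k`-signed `r`-sets on `[n]`. -/
def IsNontrivialTIntersecting (n r k t : ℕ) (𝓕 : Finset (Finset (Fin n × Fin k))) : Prop :=
  𝓕 ⊆ signedSets n r k ∧ IsTIntersecting t 𝓕 ∧ ¬ IsTrivial t 𝓕

/-- Two families are isomorphic if some bijection of `[n] × [k]` carries one onto the other. -/
def IsIsomorphic {n k : ℕ} (𝓕 𝓖 : Finset (Finset (Fin n × Fin k))) : Prop :=
  ∃ σ : Equiv.Perm (Fin n × Fin k), 𝓖 = 𝓕.image fun F => F.image σ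

/-- The signed set `M_d = {(1,1), (2,1), …, (d,1)}`. -/
def M (n k d : ℕ) : Finset (Fin n × Fin k) :=
  Finset.univ.filter fun p => (p.1 : ℕ) < d ∧ (p.2 : ℕ) = 0

/-- The family `H₁(n,r,k,ℓ,t)`. -/
def H₁ (n r k l t : ℕ) : Finset (Finset (Fin n × Fin k)) :=
  (signedSets n r k).filter fun F =>
    (M n k t ⊆ F ∧ t + 1 ≤ (F ∩ M n k l).card) ∨
    (¬ M n k t ⊆ F ∧ (F ∩ M n k l).card = l - 1)

/-- The family `H₂(n,r,k,c,t)`. -/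
def H₂ (n r k c t : ℕ) : Finset (Finset (Fin n × Fin k)) :=
  (signedSets n r k).filter fun F =>
    (M n k t ⊆ F ∧ t + 1 ≤ (F ∩ M n k r).card) ∨
    (F ∩ M n k r = M n k t ∧ M n k c \ M n k r ⊆ F) ∨
    (¬ M n k t ⊆ F ∧ (F ∩ M n k r).card = r - 1 ∧
      (F ∩ (M n k c \ M n k r)).card = 1)

/-- The function `f(n,r,k,d,t)`, for `n ≥ t + 2`, `r ≥ t + 1` and `d ≥ t`. For `r = t + 1` the
second term vanishes because its binomial coefficient `C(n-t-2, r-t-2)` has lower index `-1`. -/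
def f (n r k d t : ℕ) : ℤ :=
  ((d : ℤ) - t) * (n - t - 1).choose (r - t - 1) * (k : ℤ) ^ (r - t - 1) -
    if t + 2 ≤ r then
      ((d - t).choose 2 : ℤ) * (n - t - 2).choose (r - t - 2) * (k : ℤ) ^ (r - t - 2)
    else 0

/-- The function `g(n,r,t)`. -/
noncomputable def g (n r t : ℕ) : ℝ :=
  ((r : ℝ) - t + 3) * ((r : ℝ) - t - 1) / ((n : ℝ) - t - 1) *
    max ((t + 2).choose 2 : ℝ) (((r : ℝ) - t + 1) / 2)

end SignedSets

/-!
Write `r = t + s` and let `N j` (`starCard`) be the number of signed `r`-sets containing a fixed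
signed set of size `j`. The hypothesis on `k` says that `(s + 3) m N (j + 1) ≤ 2 N j` for
`j ≥ t + 1`, with `m = max ((t + 1) (t + 2)) (s + 1)` (`le_of_g_le`, `starCard_decay`), and
`f = s N (t + 1) - (s choose 2) N (t + 2)` (`f_eq`) is the Bonferroni lower bound for the number of
`r`-sets that contain `M_t` and meet `M_r \ M_t` (`le_card_superset_meeting`). This bounds all the
families in (i) and (ii) from below; the family in (iii) is counted exactly
(`card_filter_inter_add`).

For the converse, a set is a cover of `𝓕` if it meets all members in at least `t` elements. The
members of `𝓕` containing a set `S` which is not a cover can be distributed over larger sets, with a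
loss of a factor `s + 1` for every added element (`weight_le_of_not_cover`). Hence, if all signed
covers have at least `t + 2` elements, then `|𝓕| < f` (`card_le_of_large_cover`). By maximality
`𝓕` contains all `r`-sets containing a signed cover, and since `k ≥ 2` the signed covers of size
`t + 1` pairwise meet in at least `t` elements (`le_card_inter_of_covers`). There are three cases.

* There is only one signed cover of size `t + 1`. Then `|𝓕| < f` (`card_le_of_unique_cover`).
* Three such covers have no `t` elements in common. Then their union `Z` has size `t + 2`, and `𝓕`
  consists of the sets meeting `Z` in at least `t + 1` elements (`eq_filter_of_three_covers`), a copy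
  of `H₁(n,r,k,t+2,t)`.
* There are at least two, and they are the sets `X ∪ {y}` with `|X| = t` and `y ∈ Y`
  (`exists_sunflower`). Then `|Y| ≤ s + 1`. If `|Y| < s` then `|𝓕| < f` (`card_le_of_sunflower`);
  if `|Y| ≥ s`, maximality alone shows that `𝓕` is a copy of `H₁(n,r,k,r+1,t)`, `H₁(n,r,k,r,t)` or
  `H₂(n,r,k,c,t)` (`eq_familyOne_of_sunflower`, `eq_familyTwo_of_sunflower`).
-/

namespace SignedSets

open Finset

variable {n k : ℕ}

/-! ### Signed sets and the number of signed sets containing a given one -/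

/-- A set of pairs is signed if no two of its elements share their first coordinate. -/
def IsSigned (S : Finset (Fin n × Fin k)) : Prop :=
  ∀ p ∈ S, ∀ q ∈ S, p.1 = q.1 → p = q

theorem mem_signedSets {r : ℕ} {F : Finset (Fin n × Fin k)} :
    F ∈ signedSets n r k ↔ F.card = r ∧ IsSigned F := by
  simp [signedSets, IsSigned]

theorem IsSigned.mono {S T : Finset (Fin n × Fin k)} (hT : IsSigned T) (h : S ⊆ T) :
    IsSigned S := fun p hp q hq => hT p (h hp) q (h hq)

theorem IsSigned.card_image_fst {S : Finset (Fin n × Fin k)} (hS : IsSigned S) :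
    (S.image Prod.fst).card = S.card :=
  card_image_of_injOn fun p hp q hq h => hS p hp q hq h

theorem IsSigned.card_le {S : Finset (Fin n × Fin k)} (hS : IsSigned S) : S.card ≤ n := by
  rw [← hS.card_image_fst]
  simpa using card_le_univ (S.image Prod.fst)

theorem IsSigned.insert {S : Finset (Fin n × Fin k)} (hS : IsSigned S) {p : Fin n × Fin k}
    (hp : p.1 ∉ S.image Prod.fst) : IsSigned (insert p S) := by
  have hp' : ∀ q ∈ S, q.1 ≠ p.1 := fun q hq h => hp (mem_image.2 ⟨q, hq, h⟩)
  intro a ha b hb hab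
  rcases mem_insert.1 ha with h | h <;> rcases mem_insert.1 hb with h' | h'
  · exact h.trans h'.symm
  · exact absurd (hab.symm.trans (congrArg Prod.fst h)) (hp' b h')
  · exact absurd (hab.trans (congrArg Prod.fst h')) (hp' a h)
  · exact hS a h b h' hab

/-- The number of `k`-signed `r`-sets on `[n]` containing a given signed set of size `j`
(see `card_star`); it is `0` for `j > r`. -/
def starCard (n r k j : ℕ) : ℕ :=
  if j ≤ r then (n - j).choose (r - j) * k ^ (r - j) else 0

theorem starCard_pos {r j : ℕ} (hk : 0 < k) (hj : j ≤ r) (hrn : r ≤ n) :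
    0 < starCard n r k j := by
  rw [starCard, if_pos hj]
  exact Nat.mul_pos (Nat.choose_pos (by omega)) (pow_pos hk _)

theorem starCard_rec {r : ℕ} (hrn : r ≤ n) (j : ℕ) :
    (r - j) * starCard n r k j = (n - j) * k * starCard n r k (j + 1) := by
  rcases lt_or_ge j r with h | h
  · obtain ⟨a, rfl⟩ : ∃ a, r = j + 1 + a := ⟨r - (j + 1), by omega⟩
    obtain ⟨b, rfl⟩ : ∃ b, n = j + 1 + b := ⟨n - (j + 1), by omega⟩
    rw [starCard, starCard, if_pos (by omega), if_pos (by omega),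
      show j + 1 + a - j = a + 1 by omega, show j + 1 + b - j = b + 1 by omega,
      show j + 1 + a - (j + 1) = a by omega, show j + 1 + b - (j + 1) = b by omega]
    have := Nat.add_one_mul_choose_eq b a
    calc (a + 1) * ((b + 1).choose (a + 1) * k ^ (a + 1))
        = ((b + 1).choose (a + 1) * (a + 1)) * k ^ (a + 1) := by ring
      _ = (b + 1) * k * (b.choose a * k ^ a) := by rw [← this]; ring
  · rw [show r - j = 0 by omega, starCard, starCard, if_neg (show ¬ j + 1 ≤ r by omega)]
    simp

/-- Double counting the pairs `(p, F)` with `S ⊆ F` and `p ∈ F \ S` reduces the count for `S` to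
the counts for the sets `insert p S`. -/
theorem card_star {r : ℕ} (hrn : r ≤ n) {S : Finset (Fin n × Fin k)} (hS : IsSigned S) :
    ((signedSets n r k).filter (S ⊆ ·)).card = starCard n r k S.card := by
  rcases lt_or_ge r S.card with h | h
  · rw [starCard, if_neg (by omega), card_eq_zero, filter_eq_empty_iff]
    intro F hF hSF
    have := card_le_card hSF
    have := (mem_signedSets.1 hF).1
    omega
  · obtain ⟨d, hd⟩ : ∃ d, r = S.card + d := ⟨r - S.card, by omega⟩
    induction d generalizing S with
    | zero =>
      have : (signedSets n r k).filter (S ⊆ ·) = {S} := by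
        ext F
        rw [mem_filter, mem_signedSets, mem_singleton]
        constructor
        · rintro ⟨⟨h1, -⟩, h2⟩
          exact (eq_of_subset_of_card_le h2 (by omega)).symm
        · rintro rfl
          exact ⟨⟨by omega, hS⟩, Subset.refl _⟩
      rw [this, starCard, if_pos h, show r - S.card = 0 by omega]
      simp
    | succ d ih =>
      set P : Finset (Fin n × Fin k) := (S.image Prod.fst)ᶜ ×ˢ univ with hP
      have hPc : P.card = (n - S.card) * k := by
        rw [hP, card_product, card_compl, hS.card_image_fst]
        simp
      have hPS : ∀ p ∈ P, p ∉ S := by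
        intro p hp hpS
        simp only [hP, mem_product, mem_compl, mem_univ, and_true] at hp
        exact hp (mem_image_of_mem _ hpS)
      have hins : ∀ p ∈ P, ((signedSets n r k).filter (insert p S ⊆ ·)).card
          = starCard n r k (S.card + 1) := by
        intro p hp
        have hpc := card_insert_of_notMem (hPS p hp)
        rw [← hpc]
        refine ih (hS.insert ?_) (by omega) (by omega)
        simpa [hP] using hp
      have key := sum_card_bipartiteAbove_eq_sum_card_bipartiteBelow
        (s := P) (t := (signedSets n r k).filter (S ⊆ ·)) (fun p F => p ∈ F)
      have h1 : ∀ p ∈ P, (((signedSets n r k).filter (S ⊆ ·)).bipartiteAbove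
          (fun p F => p ∈ F) p).card = starCard n r k (S.card + 1) := by
        intro p hp
        rw [← hins p hp]
        congr 1
        ext F
        simp only [bipartiteAbove, mem_filter, insert_subset_iff]
        tauto
      have h2 : ∀ F ∈ (signedSets n r k).filter (S ⊆ ·),
          (P.bipartiteBelow (fun p F => p ∈ F) F).card = r - S.card := by
        intro F hF
        obtain ⟨hF1, hSF⟩ := mem_filter.1 hF
        obtain ⟨hFc, hFs⟩ := mem_signedSets.1 hF1
        rw [← hFc, ← card_sdiff_of_subset hSF]
        congr 1
        ext p
        simp only [bipartiteBelow, mem_filter, mem_sdiff]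
        constructor
        · rintro ⟨h1, h2⟩
          exact ⟨h2, hPS p h1⟩
        · rintro ⟨h1, h2⟩
          refine ⟨?_, h1⟩
          simp only [hP, mem_product, mem_compl, mem_univ, and_true, mem_image, not_exists, not_and]
          intro q hq hqp
          exact h2 (hFs q (hSF hq) p h1 hqp ▸ hq)
      rw [sum_congr rfl h1, sum_congr rfl h2, sum_const, sum_const, hPc, smul_eq_mul,
        smul_eq_mul, ← starCard_rec hrn, mul_comm] at key
      exact Nat.eq_of_mul_eq_mul_right (show 0 < r - S.card by omega) key.symm

theorem card_filter_superset_le {r : ℕ} (hrn : r ≤ n) {𝓕 : Finset (Finset (Fin n × Fin k))}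
    (h𝓕 : 𝓕 ⊆ signedSets n r k) (S : Finset (Fin n × Fin k)) :
    (𝓕.filter (S ⊆ ·)).card ≤ starCard n r k S.card := by
  by_cases hS : IsSigned S
  · rw [← card_star hrn hS]
    exact card_le_card (filter_subset_filter _ h𝓕)
  · rw [filter_eq_empty_iff.2, card_empty]
    · exact Nat.zero_le _
    · intro F hF hSF
      exact hS ((mem_signedSets.1 (h𝓕 hF)).2.mono hSF)

/-- With at least two signs, a signed set extends to a signed `r`-set without picking up new
elements of another given signed set. -/
theorem exists_superset_avoiding {r : ℕ} (hk : 2 ≤ k) (hrn : r ≤ n)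
    {S B : Finset (Fin n × Fin k)} (hS : IsSigned S) (hSr : S.card ≤ r) (hB : IsSigned B) :
    ∃ F ∈ signedSets n r k, S ⊆ F ∧ F ∩ B ⊆ S := by
  have hb : ∀ i : Fin n, ∃ y : Fin k, (i, y) ∉ B := by
    intro i
    by_contra! h
    have := hB _ (h ⟨0, by omega⟩) _ (h ⟨1, by omega⟩) rfl
    simp at this
  choose b hb using hb
  obtain ⟨D, hD, hDc⟩ := exists_subset_card_eq (s := (S.image Prod.fst)ᶜ) (n := r - S.card) (by
    rw [card_compl, hS.card_image_fst, Fintype.card_fin]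
    omega)
  have hDS : ∀ i ∈ D, ∀ p ∈ S, p.1 ≠ i := by
    intro i hi p hp h
    have := hD hi
    rw [mem_compl] at this
    exact this (mem_image.2 ⟨p, hp, h⟩)
  refine ⟨S ∪ D.image fun i => (i, b i), mem_signedSets.2 ⟨?_, ?_⟩, subset_union_left, ?_⟩
  · rw [card_union_of_disjoint, card_image_of_injective, hDc]
    · omega
    · intro i j h
      exact congrArg Prod.fst h
    · rw [disjoint_left]
      intro p hp h
      obtain ⟨i, hi, rfl⟩ := mem_image.1 h
      exact hDS i hi _ hp rfl
  · intro p hp q hq hpq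
    rcases mem_union.1 hp with hp | hp <;> rcases mem_union.1 hq with hq | hq
    · exact hS p hp q hq hpq
    · obtain ⟨i, hi, rfl⟩ := mem_image.1 hq
      exact absurd hpq (hDS i hi p hp)
    · obtain ⟨i, hi, rfl⟩ := mem_image.1 hp
      exact absurd hpq.symm (hDS i hi q hq)
    · obtain ⟨i, hi, rfl⟩ := mem_image.1 hq
      obtain ⟨j, hj, rfl⟩ := mem_image.1 hp
      simp only at hpq
      rw [hpq]
  · intro p hp
    obtain ⟨hp1, hp2⟩ := mem_inter.1 hp
    rcases mem_union.1 hp1 with h | h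
    · exact h
    · obtain ⟨i, -, rfl⟩ := mem_image.1 h
      exact absurd hp2 (hb i)

/-- A lower bound on the growth of `k` gives a geometric decay of `starCard`; the ratio
`(n - j) k / (r - j)` of consecutive values increases with `j`, so the bound at `j = t + 1`
suffices. -/
theorem starCard_decay {t s c j : ℕ} (hrn : t + s ≤ n) (hc : (s - 1) * c ≤ 2 * ((n - t - 1) * k))
    (hj : t + 1 ≤ j) : c * starCard n (t + s) k (j + 1) ≤ 2 * starCard n (t + s) k j := by
  rcases lt_or_ge j (t + s) with h | h
  · obtain ⟨b, rfl⟩ : ∃ b, j = t + 1 + b := ⟨j - (t + 1), by omega⟩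
    obtain ⟨a, rfl⟩ : ∃ a, s = 1 + b + (a + 1) := ⟨s - (b + 2), by omega⟩
    obtain ⟨m, rfl⟩ : ∃ m, n = t + (1 + b + (a + 1)) + m := ⟨n - (t + (1 + b + (a + 1))), by omega⟩
    have hrec := starCard_rec (k := k) hrn (t + 1 + b)
    rw [show t + (1 + b + (a + 1)) - (t + 1 + b) = a + 1 by omega,
      show t + (1 + b + (a + 1)) + m - (t + 1 + b) = a + 1 + m by omega] at hrec
    rw [show 1 + b + (a + 1) - 1 = b + a + 1 by omega,
      show t + (1 + b + (a + 1)) + m - t - 1 = b + a + 1 + m by omega] at hc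
    have h3 : (a + 1) * c ≤ 2 * ((a + 1 + m) * k) := by
      have h4 : (b + a + 1) * ((a + 1) * c) ≤ (b + a + 1) * (2 * ((a + 1 + m) * k)) := by
        have : (b + a + 1 + m) * (a + 1) ≤ (b + a + 1) * (a + 1 + m) := by nlinarith
        calc (b + a + 1) * ((a + 1) * c) = (a + 1) * ((b + a + 1) * c) := by ring
          _ ≤ (a + 1) * (2 * ((b + a + 1 + m) * k)) := Nat.mul_le_mul_left _ hc
          _ = 2 * k * ((b + a + 1 + m) * (a + 1)) := by ring
          _ ≤ 2 * k * ((b + a + 1) * (a + 1 + m)) := Nat.mul_le_mul_left _ this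
          _ = _ := by ring
      exact Nat.le_of_mul_le_mul_left h4 (by omega)
    refine Nat.le_of_mul_le_mul_left (c := a + 1) ?_ (Nat.succ_pos a)
    set N' := starCard (t + (1 + b + (a + 1)) + m) (t + (1 + b + (a + 1))) k (t + 1 + b + 1)
    calc (a + 1) * (c * N') = ((a + 1) * c) * N' := by ring
      _ ≤ (2 * ((a + 1 + m) * k)) * N' := Nat.mul_le_mul_right _ h3
      _ = 2 * ((a + 1 + m) * k * N') := by ring
      _ = _ := by rw [← hrec]; ring
  · rw [show starCard n (t + s) k (j + 1) = 0 by
      rw [starCard, if_neg (by omega)]]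
    simp

/-- The function `f` in terms of the numbers of signed `r`-sets containing a fixed signed set of
size `t + 1` and of size `t + 2`. -/
theorem f_eq {t s : ℕ} (hs : 1 ≤ s) : f n (t + s) k (t + s) t =
    s * (starCard n (t + s) k (t + 1) : ℤ) - s.choose 2 * (starCard n (t + s) k (t + 2) : ℤ) := by
  rw [f, starCard, starCard, if_pos (show t + 1 ≤ t + s by omega), ← Nat.sub_sub, ← Nat.sub_sub,
    ← Nat.sub_sub, ← Nat.sub_sub, Nat.add_sub_cancel_left]
  split_ifs <;> push_cast <;> ring

/-! ### The extremal families over arbitrary signed sets, and isomorphisms -/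

/-- The family `H₁(n,r,k,l,t)` with arbitrary sets `X ⊆ E` in place of `M_t ⊆ M_l`. -/
def familyOne (n r k l t : ℕ) (X E : Finset (Fin n × Fin k)) : Finset (Finset (Fin n × Fin k)) :=
  (signedSets n r k).filter fun F =>
    (X ⊆ F ∧ t + 1 ≤ (F ∩ E).card) ∨ (¬ X ⊆ F ∧ (F ∩ E).card = l - 1)

/-- The family `H₂(n,r,k,c,t)` with arbitrary sets `X ⊆ E ⊆ Z` in place of `M_t ⊆ M_r ⊆ M_c`. -/
def familyTwo (n r k t : ℕ) (X E Z : Finset (Fin n × Fin k)) : Finset (Finset (Fin n × Fin k)) :=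
  (signedSets n r k).filter fun F =>
    (X ⊆ F ∧ t + 1 ≤ (F ∩ E).card) ∨ (F ∩ E = X ∧ Z \ E ⊆ F) ∨
    (¬ X ⊆ F ∧ (F ∩ E).card = r - 1 ∧ (F ∩ (Z \ E)).card = 1)

theorem IsIsomorphic.card_eq {𝓕 𝓖 : Finset (Finset (Fin n × Fin k))} (h : IsIsomorphic 𝓕 𝓖) :
    𝓖.card = 𝓕.card := by
  obtain ⟨σ, rfl⟩ := h
  exact card_image_of_injective _ (image_injective σ.injective)

theorem IsSigned.image {S : Finset (Fin n × Fin k)} (hS : IsSigned S)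
    {σ : Equiv.Perm (Fin n × Fin k)} (hσ : ∀ p q, (σ p).1 = (σ q).1 ↔ p.1 = q.1) :
    IsSigned (S.image σ) := by
  intro p hp q hq hpq
  obtain ⟨p', hp', rfl⟩ := mem_image.1 hp
  obtain ⟨q', hq', rfl⟩ := mem_image.1 hq
  rw [hS p' hp' q' hq' ((hσ p' q').1 hpq)]

theorem image_filter_signedSets {r : ℕ} {σ : Equiv.Perm (Fin n × Fin k)}
    (hσ : ∀ p q, (σ p).1 = (σ q).1 ↔ p.1 = q.1) {P Q : Finset (Fin n × Fin k) → Prop}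
    [DecidablePred P] [DecidablePred Q] (hPQ : ∀ F, Q (F.image σ) ↔ P F) :
    (signedSets n r k).filter Q = ((signedSets n r k).filter P).image fun F => F.image σ := by
  have hσ' : ∀ p q, (σ.symm p).1 = (σ.symm q).1 ↔ p.1 = q.1 := by
    intro p q
    rw [← hσ, σ.apply_symm_apply, σ.apply_symm_apply]
  ext G
  rw [mem_image]
  constructor
  · intro hG
    obtain ⟨hG1, hG2⟩ := mem_filter.1 hG
    obtain ⟨hc, hs⟩ := mem_signedSets.1 hG1
    have hGi : (G.image σ.symm).image σ = G := by
      rw [image_image]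
      simp
    refine ⟨G.image σ.symm, mem_filter.2 ⟨mem_signedSets.2 ⟨?_, hs.image hσ'⟩, ?_⟩, hGi⟩
    · rw [card_image_of_injective _ σ.symm.injective, hc]
    · rw [← hPQ, hGi]
      exact hG2
  · rintro ⟨F, hF, rfl⟩
    obtain ⟨hF1, hF2⟩ := mem_filter.1 hF
    obtain ⟨hc, hs⟩ := mem_signedSets.1 hF1
    refine mem_filter.2 ⟨mem_signedSets.2 ⟨?_, hs.image hσ⟩, (hPQ F).2 hF2⟩
    rw [card_image_of_injective _ σ.injective, hc]

theorem mem_M {d : ℕ} {p : Fin n × Fin k} : p ∈ M n k d ↔ (p.1 : ℕ) < d ∧ (p.2 : ℕ) = 0 := by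
  simp [M]

theorem isSigned_M (d : ℕ) : IsSigned (M n k d) := by
  intro p hp q hq h
  rw [mem_M] at hp hq
  exact Prod.ext h (Fin.ext (hp.2.trans hq.2.symm))

theorem M_mono {c d : ℕ} (h : c ≤ d) : M n k c ⊆ M n k d := by
  intro p hp
  rw [mem_M] at hp ⊢
  exact ⟨by omega, hp.2⟩

theorem card_M {d : ℕ} (hk : 0 < k) (hd : d ≤ n) : (M n k d).card = d := by
  rw [← (isSigned_M d).card_image_fst]
  have : (M n k d).image Prod.fst = univ.filter fun i : Fin n => (i : ℕ) < d := by
    ext i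
    rw [mem_image, mem_filter]
    constructor
    · rintro ⟨p, hp, rfl⟩
      exact ⟨mem_univ _, (mem_M.1 hp).1⟩
    · rintro ⟨-, hi⟩
      exact ⟨(i, ⟨0, hk⟩), mem_M.2 ⟨hi, rfl⟩, rfl⟩
  rw [this, Fin.card_filter_val_lt, min_eq_right hd]

/-- Sorting by a level function carries all its sublevel sets to initial segments at once. -/
theorem exists_perm_lt_card (φ : Fin n → ℕ) :
    ∃ π : Equiv.Perm (Fin n), ∀ v i,
      (π i : ℕ) < (univ.filter fun j => φ j ≤ v).card ↔ φ i ≤ v := by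
  refine ⟨(Tuple.sort φ).symm, fun v i => ?_⟩
  obtain ⟨i, rfl⟩ := (Tuple.sort φ).surjective i
  rw [Equiv.symm_apply_apply]
  have hm : Monotone (φ ∘ Tuple.sort φ) := Tuple.monotone_sort φ
  have hcard : (univ.filter fun j => φ j ≤ v).card =
      (univ.filter fun j => φ (Tuple.sort φ j) ≤ v).card := by
    refine (card_equiv (Tuple.sort φ) fun j => ?_).symm
    simp
  rw [hcard]
  constructor
  · intro h
    by_contra hi
    have : (univ.filter fun j => φ (Tuple.sort φ j) ≤ v) ⊆ Iio i := by
      intro j hj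
      rw [mem_Iio]
      by_contra hij
      exact hi ((hm (not_lt.1 hij)).trans (mem_filter.1 hj).2)
    have := card_le_card this
    rw [Fin.card_Iio] at this
    omega
  · intro h
    have : Iic i ⊆ univ.filter fun j => φ (Tuple.sort φ j) ≤ v := by
      intro j hj
      exact mem_filter.2 ⟨mem_univ _, (hm (mem_Iic.1 hj)).trans h⟩
    have := card_le_card this
    rw [Fin.card_Iic] at this
    omega

/-- A chain of three signed sets can be moved to the sets `M_d` of the same sizes by a permutation
of `[n] × [k]` which permutes `[n]`, and permutes the signs over each element of `[n]`. -/
theorem exists_perm_image_eq_M (hk : 0 < k) {A B C : Finset (Fin n × Fin k)} (hC : IsSigned C)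
    (hAB : A ⊆ B) (hBC : B ⊆ C) :
    ∃ σ : Equiv.Perm (Fin n × Fin k), (∀ p q, (σ p).1 = (σ q).1 ↔ p.1 = q.1) ∧
      A.image σ = M n k A.card ∧ B.image σ = M n k B.card ∧ C.image σ = M n k C.card := by
  have hb : ∀ i, ∃ y : Fin k, i ∈ C.image Prod.fst → (i, y) ∈ C := by
    intro i
    by_cases h : i ∈ C.image Prod.fst
    · obtain ⟨p, hp, rfl⟩ := mem_image.1 h
      exact ⟨p.2, fun _ => hp⟩
    · exact ⟨⟨0, hk⟩, fun h' => absurd h' h⟩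
  choose b hb using hb
  have hAB' := image_subset_image (f := Prod.fst) hAB
  have hBC' := image_subset_image (f := Prod.fst) hBC
  set φ : Fin n → ℕ := fun i => if i ∈ A.image Prod.fst then 0 else
    if i ∈ B.image Prod.fst then 1 else if i ∈ C.image Prod.fst then 2 else 3 with hφ
  have h0 : ∀ i, φ i ≤ 0 ↔ i ∈ A.image Prod.fst := by
    intro i
    simp only [hφ]
    split_ifs <;> simp_all
  have h1 : ∀ i, φ i ≤ 1 ↔ i ∈ B.image Prod.fst := by
    intro i
    have := @hAB' i
    simp only [hφ]
    split_ifs <;> simp_all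
  have h2 : ∀ i, φ i ≤ 2 ↔ i ∈ C.image Prod.fst := by
    intro i
    have := @hAB' i
    have := @hBC' i
    simp only [hφ]
    split_ifs <;> simp_all
  obtain ⟨π, hπ⟩ := exists_perm_lt_card φ
  set σ : Equiv.Perm (Fin n × Fin k) :=
    Equiv.prodShear π fun i => Equiv.swap (b i) ⟨0, hk⟩ with hσ
  have hσ1 : ∀ p, (σ p).1 = π p.1 := fun p => rfl
  have hσ2 : ∀ p, (σ p).2 = Equiv.swap (b p.1) ⟨0, hk⟩ p.2 := fun p => rfl
  have key : ∀ v, ∀ D ⊆ C, (∀ i, φ i ≤ v ↔ i ∈ D.image Prod.fst) →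
      D.image σ = M n k D.card := by
    intro v D hDC hD
    have hDc : (univ.filter fun j => φ j ≤ v).card = D.card := by
      rw [← (hC.mono hDC).card_image_fst]
      congr 1
      ext i
      simp only [mem_filter, mem_univ, true_and]
      exact hD i
    ext p
    obtain ⟨q, rfl⟩ := σ.surjective p
    have hswap : ((Equiv.swap (b q.1) ⟨0, hk⟩ q.2 : Fin k) : ℕ) = 0 ↔ q.2 = b q.1 := by
      have : Equiv.swap (b q.1) ⟨0, hk⟩ q.2 = ⟨0, hk⟩ ↔ q.2 = b q.1 := by
        rw [Equiv.swap_apply_eq_iff, Equiv.swap_apply_right]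
      rw [← this, Fin.ext_iff]
    rw [σ.injective.mem_finset_image, mem_M, hσ1, hσ2, ← hDc, hπ, hD, hswap]
    constructor
    · intro hq
      have hq1 := mem_image_of_mem Prod.fst hq
      exact ⟨hq1, congrArg Prod.snd
        (hC q (hDC hq) (q.1, b q.1) (hb _ (image_subset_image hDC hq1)) rfl)⟩
    · rintro ⟨hq1, hq2⟩
      obtain ⟨p, hp, hpq⟩ := mem_image.1 hq1
      have := hC p (hDC hp) (q.1, b q.1) (hb _ (image_subset_image hDC hq1)) hpq
      rwa [this, ← hq2] at hp
  refine ⟨σ, fun p q => ?_, key 0 A (hAB.trans hBC) h0, key 1 B hBC h1,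
    key 2 C (Subset.refl _) h2⟩
  rw [hσ1, hσ1, π.injective.eq_iff]

theorem isIsomorphic_familyOne {r l t : ℕ} (hk : 0 < k) {X E : Finset (Fin n × Fin k)}
    (hE : IsSigned E) (hXE : X ⊆ E) (hX : X.card = t) (hEc : E.card = l) :
    IsIsomorphic (familyOne n r k l t X E) (H₁ n r k l t) := by
  obtain ⟨σ, hσ, h1, h2, -⟩ := exists_perm_image_eq_M hk hE hXE (Subset.refl _)
  refine ⟨σ, image_filter_signedSets hσ fun F => ?_⟩
  rw [← hX, ← hEc, ← h1, ← h2, image_subset_image_iff σ.injective,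
    ← image_inter _ _ σ.injective, card_image_of_injective _ σ.injective]

theorem isIsomorphic_familyTwo {r c t : ℕ} (hk : 0 < k) {X E Z : Finset (Fin n × Fin k)}
    (hZ : IsSigned Z) (hXE : X ⊆ E) (hEZ : E ⊆ Z) (hX : X.card = t) (hE : E.card = r)
    (hZc : Z.card = c) : IsIsomorphic (familyTwo n r k t X E Z) (H₂ n r k c t) := by
  obtain ⟨σ, hσ, h1, h2, h3⟩ := exists_perm_image_eq_M hk hZ hXE hEZ
  refine ⟨σ, image_filter_signedSets hσ fun F => ?_⟩
  rw [← hX, ← hE, ← hZc, ← h1, ← h2, ← h3, image_subset_image_iff σ.injective,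
    ← image_sdiff _ _ σ.injective, image_subset_image_iff σ.injective,
    ← image_inter _ _ σ.injective, ← image_inter _ _ σ.injective,
    card_image_of_injective _ σ.injective, card_image_of_injective _ σ.injective,
    (image_injective σ.injective).eq_iff]

/-! ### Sizes of the extremal families -/

/-- The Bonferroni inequality for the signed `r`-sets that contain `X` and meet `Y`. -/
theorem le_card_superset_meeting {r t : ℕ} (hrn : r ≤ n) {X Y : Finset (Fin n × Fin k)}
    (hXY : Disjoint X Y) (hS : IsSigned (X ∪ Y)) (hX : X.card = t) :
    (Y.card : ℤ) * starCard n r k (t + 1) - Y.card.choose 2 * starCard n r k (t + 2) ≤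
      ((signedSets n r k).filter fun F => X ⊆ F ∧ ∃ y ∈ Y, y ∈ F).card := by
  induction Y using Finset.induction_on with
  | empty => simp
  | insert a Y ha ih =>
    rw [disjoint_insert_right] at hXY
    have ih := ih hXY.2 (hS.mono (union_subset_union_right (subset_insert _ _)))
    have hA : ((signedSets n r k).filter (insert a X ⊆ ·)).card = starCard n r k (t + 1) := by
      rw [card_star hrn, card_insert_of_notMem hXY.1, hX]
      refine hS.mono (insert_subset (mem_union_right _ (mem_insert_self _ _)) subset_union_left)
    have hB : ((signedSets n r k).filter fun F => insert a X ⊆ F ∧ ∃ y ∈ Y, y ∈ F).card ≤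
        Y.card * starCard n r k (t + 2) := by
      refine (card_le_card (t := Y.biUnion fun y =>
        (signedSets n r k).filter (insert y (insert a X) ⊆ ·)) ?_).trans
        (card_biUnion_le_card_mul _ _ _ fun y hy => ?_)
      · intro F hF
        simp only [mem_filter, mem_biUnion] at hF ⊢
        obtain ⟨h1, h2, y, hy, hyF⟩ := hF
        exact ⟨y, hy, h1, insert_subset hyF h2⟩
      · refine (card_filter_superset_le hrn (Subset.refl _) _).trans_eq ?_
        rw [card_insert_of_notMem, card_insert_of_notMem hXY.1, hX]
        rw [mem_insert, not_or]
        exact ⟨fun h => ha (h ▸ hy), fun h => disjoint_left.1 hXY.2 h hy⟩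
    have hunion : ((signedSets n r k).filter fun F => X ⊆ F ∧ ∃ y ∈ insert a Y, y ∈ F) =
        (signedSets n r k).filter (insert a X ⊆ ·) ∪
          (signedSets n r k).filter fun F => X ⊆ F ∧ ∃ y ∈ Y, y ∈ F := by
      ext F
      simp only [mem_filter, mem_union, insert_subset_iff, mem_insert, exists_eq_or_imp]
      tauto
    have hinter : (signedSets n r k).filter (insert a X ⊆ ·) ∩
          ((signedSets n r k).filter fun F => X ⊆ F ∧ ∃ y ∈ Y, y ∈ F) =
        (signedSets n r k).filter fun F => insert a X ⊆ F ∧ ∃ y ∈ Y, y ∈ F := by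
      ext F
      simp only [mem_filter, mem_inter, insert_subset_iff]
      tauto
    have hc := card_union_add_card_inter ((signedSets n r k).filter (insert a X ⊆ ·))
      ((signedSets n r k).filter fun F => X ⊆ F ∧ ∃ y ∈ Y, y ∈ F)
    rw [hinter, hA, ← hunion] at hc
    rw [card_insert_of_notMem ha, Nat.choose_succ_succ' Y.card 1, Nat.choose_one_right]
    push_cast
    zify at hc hB
    linarith

theorem le_card_of_superset_meeting {t s : ℕ} (hs : 1 ≤ s) (hk : 0 < k) (hrn : t + s ≤ n)
    {𝓖 : Finset (Finset (Fin n × Fin k))}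
    (h : ∀ F ∈ signedSets n (t + s) k, M n k t ⊆ F →
      t + 1 ≤ (F ∩ M n k (t + s)).card → F ∈ 𝓖) :
    f n (t + s) k (t + s) t ≤ 𝓖.card := by
  have hM : M n k t ⊆ M n k (t + s) := M_mono (by omega)
  have hc : (M n k (t + s) \ M n k t).card = s := by
    rw [card_sdiff_of_subset hM, card_M hk hrn, card_M hk (by omega)]
    omega
  have key := le_card_superset_meeting (r := t + s) hrn
    (X := M n k t) (Y := M n k (t + s) \ M n k t) disjoint_sdiff
    (by rw [union_sdiff_of_subset hM]; exact isSigned_M _) (card_M hk (by omega))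
  rw [hc] at key
  rw [f_eq hs]
  refine key.trans ?_
  norm_cast
  refine card_le_card fun F hF => ?_
  simp only [mem_filter] at hF
  obtain ⟨h1, h2, y, hy, hyF⟩ := hF
  refine h F h1 h2 ?_
  rw [mem_sdiff] at hy
  have := card_le_card (insert_subset (mem_inter.2 ⟨hyF, hy.1⟩) (subset_inter h2 hM))
  rwa [card_insert_of_notMem hy.2, card_M hk (by omega)] at this

/-- Counting the pairs `(x, F)` with `x ∈ Z` and `Z \ {x} ⊆ F`, where a set `F ⊇ Z` is counted
`t + 2` times. -/
theorem card_filter_inter_add {r t : ℕ} (hrn : r ≤ n) {Z : Finset (Fin n × Fin k)}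
    (hZ : IsSigned Z) (hZc : Z.card = t + 2) :
    ((signedSets n r k).filter fun F => t + 1 ≤ (F ∩ Z).card).card +
      (t + 1) * starCard n r k (t + 2) = (t + 2) * starCard n r k (t + 1) := by
  have hZ2 : ((signedSets n r k).filter (Z ⊆ ·)).card = starCard n r k (t + 2) := by
    rw [card_star hrn hZ, hZc]
  have hx : ∀ x ∈ Z, ((signedSets n r k).filter (Z.erase x ⊆ ·)).card =
      starCard n r k (t + 1) := by
    intro x hx
    rw [card_star hrn (hZ.mono (erase_subset _ _)), card_erase_of_mem hx, hZc]
    rfl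
  have key := sum_card_bipartiteAbove_eq_sum_card_bipartiteBelow
        (s := Z) (t := signedSets n r k) (fun x F => Z.erase x ⊆ F)
  have h1 : ∀ x ∈ Z, ((signedSets n r k).bipartiteAbove (fun x F => Z.erase x ⊆ F) x).card =
      starCard n r k (t + 1) := fun x h => hx x h
  have h2 : ∀ F ∈ signedSets n r k, (Z.bipartiteBelow (fun x F => Z.erase x ⊆ F) F).card =
      (if t + 1 ≤ (F ∩ Z).card then 1 else 0) + (t + 1) * (if Z ⊆ F then 1 else 0) := by
    intro F _
    have hFZ : (F ∩ Z).card ≤ t + 2 := hZc ▸ card_le_card inter_subset_right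
    by_cases hZF : Z ⊆ F
    · rw [if_pos hZF, inter_eq_right.2 hZF, hZc, if_pos (by omega)]
      have : Z.bipartiteBelow (fun x F => Z.erase x ⊆ F) F = Z :=
        filter_true_of_mem fun x _ => (erase_subset x Z).trans hZF
      rw [this, hZc]
      ring
    · rw [if_neg hZF]
      split_ifs with h
      · have hlt : (F ∩ Z).card < Z.card := card_lt_card
          ⟨inter_subset_right, fun h' => hZF (h'.trans inter_subset_left)⟩
        have hone : (Z \ F).card = 1 := by
          have := card_sdiff_add_card_inter Z F
          rw [inter_comm] at this
          omega
        obtain ⟨x, hxZ⟩ := card_eq_one.1 hone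
        have : Z.bipartiteBelow (fun x F => Z.erase x ⊆ F) F = {x} := by
          rw [← hxZ]
          ext y
          simp only [bipartiteBelow, mem_filter, mem_sdiff]
          refine and_congr_right fun hy => ⟨fun h1 hyF => hZF fun z hz => ?_, fun hyF z hz => ?_⟩
          · by_cases hzy : z = y
            · exact hzy ▸ hyF
            · exact h1 (mem_erase.2 ⟨hzy, hz⟩)
          · by_contra hzF
            have hz' : z ∈ Z \ F := mem_sdiff.2 ⟨(mem_erase.1 hz).2, hzF⟩
            have hy' : y ∈ Z \ F := mem_sdiff.2 ⟨hy, hyF⟩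
            rw [hxZ, mem_singleton] at hz' hy'
            exact (mem_erase.1 hz).1 (hz'.trans hy'.symm)
        rw [this, card_singleton, mul_zero, add_zero]
      · rw [mul_zero, add_zero, card_eq_zero]
        refine filter_eq_empty_iff.2 fun x hx hxF => h ?_
        have := card_le_card (subset_inter hxF (erase_subset x Z))
        rw [card_erase_of_mem hx, hZc] at this
        exact this
  rw [sum_congr rfl h1, sum_congr rfl h2, sum_const, sum_add_distrib, ← mul_sum, ← card_filter,
    ← card_filter, hZ2, hZc, smul_eq_mul] at key
  exact key.symm

theorem familyOne_eq_filter {r t : ℕ} {X Z : Finset (Fin n × Fin k)} (hXZ : X ⊆ Z)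
    (hZc : Z.card = t + 2) : familyOne n r k (t + 2) t X Z =
      (signedSets n r k).filter fun F => t + 1 ≤ (F ∩ Z).card := by
  refine filter_congr fun F _ => ?_
  have hFZ : (F ∩ Z).card ≤ t + 2 := hZc ▸ card_le_card inter_subset_right
  by_cases hX : X ⊆ F
  · simp [hX]
  · have : (F ∩ Z).card < t + 2 := hZc ▸ card_lt_card
      ⟨inter_subset_right, fun h' => hX ((hXZ.trans h').trans inter_subset_left)⟩
    simp only [hX, false_and, not_false_eq_true, true_and, false_or]
    omega

/-! ### Numerical inequalities -/

theorem choose_add_le_pow (s i : ℕ) : (s + i).choose i ≤ (s + 1) ^ i := by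
  induction i with
  | zero => simp
  | succ i ih =>
    have h := Nat.add_one_mul_choose_eq (s + i) i
    refine Nat.le_of_mul_le_mul_right (c := i + 1) ?_ (Nat.succ_pos i)
    rw [← add_assoc, ← h, pow_succ]
    have : s + i + 1 ≤ (s + 1) * (i + 1) := by nlinarith
    calc (s + i + 1) * (s + i).choose i ≤ ((s + 1) * (i + 1)) * (s + 1) ^ i :=
          Nat.mul_le_mul this ih
      _ = _ := by ring

theorem two_mul_choose_two (s : ℕ) : 2 * (s.choose 2 : ℤ) = s * (s - 1) := by
  induction s with
  | zero => simp
  | succ s ih =>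
    rw [Nat.choose_succ_succ' s 1, Nat.choose_one_right]
    push_cast
    linarith

/-- All size comparisons reduce to coefficient inequalities: a bound `a ≥ q b / 2` lets a multiple
of `a` absorb a multiple of `b`. -/
theorem mul_lt_of_coeff_lt {e q c a b : ℤ} (he : 0 ≤ e) (hb : 0 < b) (h : c < e * q)
    (hq : q * b ≤ 2 * a) : c * b < e * (2 * a) :=
  calc c * b < e * q * b := mul_lt_mul_of_pos_right h hb
    _ = e * (q * b) := by ring
    _ ≤ e * (2 * a) := mul_le_mul_of_nonneg_left hq he

theorem coeff_large_cover {s t m : ℤ} (hs : 2 ≤ s) (hP : (t + 1) * (t + 2) ≤ m)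
    (hQ : s + 1 ≤ m) : (t + 1) * (t + 2) * (s + 1) ^ 2 + s * (s - 1) < s * ((s + 3) * m) := by
  have h1 : (t + 1) * (t + 2) * (s + 1) ^ 2 ≤ m * (s + 1) ^ 2 :=
    mul_le_mul_of_nonneg_right hP (sq_nonneg _)
  have h2 : (s - 1) * (s + 1) ≤ (s - 1) * m := mul_le_mul_of_nonneg_left hQ (by omega)
  nlinarith

theorem coeff_one_cover {s t m : ℤ} (hs : 2 ≤ s) (ht : 1 ≤ t) (hP : (t + 1) * (t + 2) ≤ m) :
    2 * ((t + 1) * (s * (s + 1))) + s * (s - 1) < (s - 1) * ((s + 3) * m) := by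
  have h1 : (s - 1) * (s + 3) * ((t + 1) * (t + 2)) ≤ (s - 1) * (s + 3) * m :=
    mul_le_mul_of_nonneg_left hP (by nlinarith)
  obtain ⟨a, rfl⟩ : ∃ a, s = a + 2 := ⟨s - 2, by ring⟩
  obtain ⟨b, rfl⟩ : ∃ b, t = b + 1 := ⟨t - 1, by ring⟩
  have ha : 0 ≤ a := by omega
  have hb : 0 ≤ b := by omega
  have : 0 ≤ a * b := mul_nonneg ha hb
  have : 0 ≤ a * a * b := mul_nonneg (mul_nonneg ha ha) hb
  have : 0 ≤ a * a * (b * b) := mul_nonneg (mul_nonneg ha ha) (mul_nonneg hb hb)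
  have : 0 ≤ a * (b * b) := mul_nonneg ha (mul_nonneg hb hb)
  nlinarith

theorem coeff_two_covers {s t m : ℤ} (hs : 3 ≤ s) (ht : 1 ≤ t) (hP : (t + 1) * (t + 2) ≤ m) :
    2 * ((s - 1) * (s + 1)) + 2 * (t * (s + 1)) + s * (s - 1) < (s - 2) * ((s + 3) * m) := by
  have h1 : (s - 2) * (s + 3) * ((t + 1) * (t + 2)) ≤ (s - 2) * (s + 3) * m :=
    mul_le_mul_of_nonneg_left hP (by nlinarith)
  obtain ⟨a, rfl⟩ : ∃ a, s = a + 3 := ⟨s - 3, by ring⟩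
  obtain ⟨b, rfl⟩ : ∃ b, t = b + 1 := ⟨t - 1, by ring⟩
  have ha : 0 ≤ a := by omega
  have hb : 0 ≤ b := by omega
  have : 0 ≤ a * b := mul_nonneg ha hb
  have : 0 ≤ a * a * b := mul_nonneg (mul_nonneg ha ha) hb
  have : 0 ≤ a * a * (b * b) := mul_nonneg (mul_nonneg ha ha) (mul_nonneg hb hb)
  have : 0 ≤ a * (b * b) := mul_nonneg ha (mul_nonneg hb hb)
  nlinarith

theorem coeff_many_covers {s t m e : ℤ} (hs : e + 3 ≤ s) (he : 1 ≤ e) (ht : 1 ≤ t)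
    (hP : (t + 1) * (t + 2) ≤ m) (hQ : s + 1 ≤ m) :
    2 * ((e + 1) * (s + 1)) + 2 * t + s * (s - 1) < e * ((s + 3) * m) := by
  -- for large `s` the bound `s + 1 ≤ m` is the effective one, otherwise `(t + 1) (t + 2) ≤ m` is
  have h6 : 6 ≤ m := by nlinarith
  have h1 : 4 * (s + 1) + 2 * t + s * (s - 1) < (s + 3) * m := by
    rcases le_or_gt s (2 * t + 1) with h | h
    · have h2 : (s + 3) * ((t + 1) * (t + 2)) ≤ (s + 3) * m :=
        mul_le_mul_of_nonneg_left hP (by omega)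
      have h3 : s * (s - 1) ≤ s * (2 * t) := mul_le_mul_of_nonneg_left (by omega) (by omega)
      nlinarith [mul_nonneg (show 0 ≤ s by omega) (show 0 ≤ t - 1 by omega)]
    · have h2 : (s + 3) * (s + 1) ≤ (s + 3) * m := mul_le_mul_of_nonneg_left hQ (by omega)
      nlinarith
  nlinarith [mul_nonneg (show 0 ≤ e - 1 by omega) (show 0 ≤ (s + 3) * m - 2 * (s + 1) by nlinarith)]

/-! ### Upper bounds from covers

A set `S` covers `𝓕` if it meets every member in at least `t` elements. -/

section Bounds

variable {t s m : ℕ} {𝓕 : Finset (Finset (Fin n × Fin k))}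

/-- If `S` does not cover `𝓕`, a member of `𝓕` that meets `S` in only `t - i` elements has
`s + i` elements outside `S`, and the members containing `S` contain `i` of these. As there are at
most `(s + 1) ^ i` choices, the number of members containing `S`, weighted by `(s + 1) ^ |S|`, is
at most the largest weighted number for a larger set. -/
theorem weight_le_of_not_cover (h𝓕 : 𝓕 ⊆ signedSets n (t + s) k) (hint : IsTIntersecting t 𝓕)
    {S F₀ : Finset (Fin n × Fin k)} (hF₀ : F₀ ∈ 𝓕) (hlt : (S ∩ F₀).card < t) {B : ℕ}
    (hB : ∀ S', S.card < S'.card → (𝓕.filter (S' ⊆ ·)).card * (s + 1) ^ S'.card ≤ B) :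
    (𝓕.filter (S ⊆ ·)).card * (s + 1) ^ S.card ≤ B := by
  obtain ⟨i, hi⟩ : ∃ i, t = (S ∩ F₀).card + i := ⟨t - (S ∩ F₀).card, by omega⟩
  have hsd : (F₀ \ S).card = s + i := by
    have h1 := card_sdiff_add_card_inter F₀ S
    rw [(mem_signedSets.1 (h𝓕 hF₀)).1, inter_comm] at h1
    omega
  have hSA : ∀ A ∈ (F₀ \ S).powersetCard i, (S ∪ A).card = S.card + i := by
    intro A hA
    obtain ⟨hA1, hA2⟩ := mem_powersetCard.1 hA
    rw [card_union_of_disjoint (disjoint_of_subset_right hA1 disjoint_sdiff), hA2]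
  have hsub : 𝓕.filter (S ⊆ ·) ⊆
      ((F₀ \ S).powersetCard i).biUnion fun A => 𝓕.filter (S ∪ A ⊆ ·) := by
    intro F hF
    obtain ⟨hF, hSF⟩ := mem_filter.1 hF
    have h1 : i ≤ ((F ∩ F₀) \ S).card := by
      have h2 := hint F hF F₀ hF₀
      have h3 := card_sdiff_add_card_inter (F ∩ F₀) S
      have h4 : ((F ∩ F₀) ∩ S).card ≤ (S ∩ F₀).card := card_le_card fun x hx => by
        simp only [mem_inter] at hx ⊢
        exact ⟨hx.2, hx.1.2⟩
      omega
    obtain ⟨A, hA, hAc⟩ := exists_subset_card_eq h1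
    refine mem_biUnion.2 ⟨A, mem_powersetCard.2 ⟨hA.trans
      (sdiff_subset_sdiff inter_subset_right (Subset.refl _)), hAc⟩,
      mem_filter.2 ⟨hF, union_subset hSF fun x hx => ?_⟩⟩
    exact (mem_inter.1 (mem_sdiff.1 (hA hx)).1).1
  refine Nat.le_of_mul_le_mul_right (c := (s + 1) ^ i) ?_ (pow_pos (Nat.succ_pos s) i)
  calc (𝓕.filter (S ⊆ ·)).card * (s + 1) ^ S.card * (s + 1) ^ i
      = (𝓕.filter (S ⊆ ·)).card * (s + 1) ^ (S.card + i) := by rw [pow_add, mul_assoc]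
    _ ≤ (∑ A ∈ (F₀ \ S).powersetCard i, (𝓕.filter (S ∪ A ⊆ ·)).card) *
          (s + 1) ^ (S.card + i) :=
        Nat.mul_le_mul_right _ ((card_le_card hsub).trans card_biUnion_le)
    _ = ∑ A ∈ (F₀ \ S).powersetCard i,
          (𝓕.filter (S ∪ A ⊆ ·)).card * (s + 1) ^ (S ∪ A).card := by
        rw [sum_mul]
        exact sum_congr rfl fun A hA => by rw [hSA A hA]
    _ ≤ ∑ A ∈ (F₀ \ S).powersetCard i, B :=
        sum_le_sum fun A hA => hB _ (by rw [hSA A hA]; omega)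
    _ = (s + i).choose i * B := by rw [sum_const, card_powersetCard, hsd, smul_eq_mul]
    _ ≤ (s + 1) ^ i * B := Nat.mul_le_mul_right _ (choose_add_le_pow s i)
    _ = B * (s + 1) ^ i := mul_comm _ _

theorem weight_antitone (hP : (t + 1) * (t + 2) ≤ m)
    (hdec : ∀ j, t + 1 ≤ j →
      (s + 3) * m * starCard n (t + s) k (j + 1) ≤ 2 * starCard n (t + s) k j)
    {i j : ℕ} (hi : t + 1 ≤ i) (hij : i ≤ j) :
    starCard n (t + s) k j * (s + 1) ^ j ≤ starCard n (t + s) k i * (s + 1) ^ i := by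
  induction j, hij using Nat.le_induction with
  | base => exact le_rfl
  | succ j hij ih =>
    refine le_trans ?_ ih
    have h1 := hdec j (hi.trans hij)
    have hm : 2 ≤ m := le_trans (by nlinarith) hP
    have h2 : 2 * (s + 1) ≤ (s + 3) * m := by nlinarith
    have h3 : (s + 1) * starCard n (t + s) k (j + 1) ≤ starCard n (t + s) k j := by nlinarith
    calc starCard n (t + s) k (j + 1) * (s + 1) ^ (j + 1)
        = ((s + 1) * starCard n (t + s) k (j + 1)) * (s + 1) ^ j := by ring
      _ ≤ _ := Nat.mul_le_mul_right _ h3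

theorem weight_le_of_card_le (hrn : t + s ≤ n) (h𝓕 : 𝓕 ⊆ signedSets n (t + s) k)
    (hP : (t + 1) * (t + 2) ≤ m)
    (hdec : ∀ j, t + 1 ≤ j →
      (s + 3) * m * starCard n (t + s) k (j + 1) ≤ 2 * starCard n (t + s) k j)
    {u : ℕ} (hu : t + 1 ≤ u) {S : Finset (Fin n × Fin k)} (hS : u ≤ S.card) :
    (𝓕.filter (S ⊆ ·)).card * (s + 1) ^ S.card ≤ starCard n (t + s) k u * (s + 1) ^ u :=
  (Nat.mul_le_mul_right _ (card_filter_superset_le hrn h𝓕 S)).trans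
    (weight_antitone hP hdec hu hS)

/-- If no signed set with fewer than `u` elements covers `𝓕`, enlarging sets repeatedly bounds the
weighted number of members containing any `S` by its value for a set of size `u`. -/
theorem weight_le (hrn : t + s ≤ n) (h𝓕 : 𝓕 ⊆ signedSets n (t + s) k)
    (hint : IsTIntersecting t 𝓕) (hP : (t + 1) * (t + 2) ≤ m)
    (hdec : ∀ j, t + 1 ≤ j →
      (s + 3) * m * starCard n (t + s) k (j + 1) ≤ 2 * starCard n (t + s) k j)
    {u : ℕ} (hu : t + 1 ≤ u)
    (hcov : ∀ S, IsSigned S → S.card < u → ∃ F ∈ 𝓕, (S ∩ F).card < t)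
    (S : Finset (Fin n × Fin k)) :
    (𝓕.filter (S ⊆ ·)).card * (s + 1) ^ S.card ≤ starCard n (t + s) k u * (s + 1) ^ u := by
  induction hd : u - S.card using Nat.strong_induction_on generalizing S with
  | _ d ih =>
    rcases le_or_gt u S.card with h | h
    · exact weight_le_of_card_le hrn h𝓕 hP hdec hu h
    · by_cases hS : IsSigned S
      · obtain ⟨F₀, hF₀, hlt⟩ := hcov S hS h
        exact weight_le_of_not_cover h𝓕 hint hF₀ hlt fun S' hS' => ih (u - S'.card) (by omega) S' rfl
      · rw [filter_eq_empty_iff.2, card_empty, zero_mul]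
        · exact Nat.zero_le _
        · intro F hF hSF
          exact hS ((mem_signedSets.1 (h𝓕 hF)).2.mono hSF)

theorem card_superset_le_of_not_cover (hrn : t + s ≤ n) (h𝓕 : 𝓕 ⊆ signedSets n (t + s) k)
    (hint : IsTIntersecting t 𝓕) (hP : (t + 1) * (t + 2) ≤ m)
    (hdec : ∀ j, t + 1 ≤ j →
      (s + 3) * m * starCard n (t + s) k (j + 1) ≤ 2 * starCard n (t + s) k j)
    {S : Finset (Fin n × Fin k)} (hS : S.card = t + 1)
    (hcov : IsSigned S → ∃ F ∈ 𝓕, (S ∩ F).card < t) :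
    (𝓕.filter (S ⊆ ·)).card ≤ (s + 1) * starCard n (t + s) k (t + 2) := by
  by_cases hSs : IsSigned S
  · obtain ⟨F₀, hF₀, hlt⟩ := hcov hSs
    have := weight_le_of_not_cover h𝓕 hint hF₀ hlt
      fun S' hS' => weight_le_of_card_le hrn h𝓕 hP hdec (u := t + 2) (by omega) (by omega)
    refine Nat.le_of_mul_le_mul_right (c := (s + 1) ^ (t + 1)) ?_ (pow_pos (Nat.succ_pos s) _)
    rw [hS] at this
    calc _ ≤ _ := this
      _ = _ := by ring
  · rw [filter_eq_empty_iff.2, card_empty]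
    · exact Nat.zero_le _
    · intro F hF hSF
      exact hSs ((mem_signedSets.1 (h𝓕 hF)).2.mono hSF)

/-- If no signed set of size `t + 1` covers `𝓕`, then a smallest cover, of size `u`, leaves
`(u choose t)` possibilities for `t` common elements, and each can be extended `u - t` times with a
factor `s + 1`. The resulting bound decreases with `u`. -/
theorem card_le_of_large_cover (hrn : t + s ≤ n) (h𝓕 : 𝓕 ⊆ signedSets n (t + s) k)
    (hint : IsTIntersecting t 𝓕) (hP : (t + 1) * (t + 2) ≤ m)
    (hdec : ∀ j, t + 1 ≤ j →
      (s + 3) * m * starCard n (t + s) k (j + 1) ≤ 2 * starCard n (t + s) k j)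
    {u : ℕ} (hu : t + 2 ≤ u)
    (hcov : ∀ S, IsSigned S → S.card < u → ∃ F ∈ 𝓕, (S ∩ F).card < t)
    {T : Finset (Fin n × Fin k)} (hT : T.card = u) (hTcov : ∀ F ∈ 𝓕, t ≤ (T ∩ F).card) :
    𝓕.card ≤ (t + 2).choose t * (s + 1) ^ 2 * starCard n (t + s) k (t + 2) := by
  have hmono : ∀ j, t + 2 ≤ j →
      j.choose t * (starCard n (t + s) k j * (s + 1) ^ j) ≤
        (t + 2).choose t * (starCard n (t + s) k (t + 2) * (s + 1) ^ (t + 2)) := by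
    intro j hj
    induction j, hj using Nat.le_induction with
    | base => exact le_rfl
    | succ j hj ih =>
      refine le_trans ?_ ih
      obtain ⟨i, rfl⟩ : ∃ i, j = t + i := ⟨j - t, by omega⟩
      have h1 := hdec (t + i) (by omega)
      have h2 := Nat.choose_mul_succ_eq (t + i) t
      rw [show t + i + 1 - t = i + 1 by omega] at h2
      have h3 : 2 * (t + i + 1) * (s + 1) ≤ (i + 1) * ((s + 3) * m) := by
        have hm : 2 * (t + 1) ≤ m := le_trans (by nlinarith) hP
        have : 2 * (t + i + 1) ≤ (i + 1) * m := by nlinarith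
        nlinarith
      refine Nat.le_of_mul_le_mul_left (c := 2 * (i + 1)) ?_ (by omega)
      set c := (t + i).choose t
      set N := starCard n (t + s) k (t + i + 1)
      calc 2 * (i + 1) * ((t + i + 1).choose t * (N * (s + 1) ^ (t + i + 1)))
          = 2 * ((t + i + 1).choose t * (i + 1)) * (s + 1) * N * (s + 1) ^ (t + i) := by ring
        _ = c * (s + 1) ^ (t + i) * (2 * (t + i + 1) * (s + 1)) * N := by rw [← h2]; ring
        _ ≤ c * (s + 1) ^ (t + i) * ((i + 1) * ((s + 3) * m)) * N :=
            Nat.mul_le_mul_right _ (Nat.mul_le_mul_left _ h3)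
        _ = c * (s + 1) ^ (t + i) * (i + 1) * ((s + 3) * m * N) := by ring
        _ ≤ c * (s + 1) ^ (t + i) * (i + 1) * (2 * starCard n (t + s) k (t + i)) :=
            Nat.mul_le_mul_left _ h1
        _ = _ := by ring
  have hsub : 𝓕 ⊆ (T.powersetCard t).biUnion fun A => 𝓕.filter (A ⊆ ·) := by
    intro F hF
    obtain ⟨A, hA, hAc⟩ := exists_subset_card_eq (hTcov F hF)
    exact mem_biUnion.2 ⟨A, mem_powersetCard.2 ⟨hA.trans inter_subset_left, hAc⟩,
      mem_filter.2 ⟨hF, hA.trans inter_subset_right⟩⟩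
  refine Nat.le_of_mul_le_mul_right (c := (s + 1) ^ t) ?_ (pow_pos (Nat.succ_pos s) _)
  calc 𝓕.card * (s + 1) ^ t
      ≤ (∑ A ∈ T.powersetCard t, (𝓕.filter (A ⊆ ·)).card) * (s + 1) ^ t :=
        Nat.mul_le_mul_right _ ((card_le_card hsub).trans card_biUnion_le)
    _ = ∑ A ∈ T.powersetCard t, (𝓕.filter (A ⊆ ·)).card * (s + 1) ^ A.card := by
        rw [sum_mul]
        exact sum_congr rfl fun A hA => by rw [(mem_powersetCard.1 hA).2]
    _ ≤ ∑ A ∈ T.powersetCard t, starCard n (t + s) k u * (s + 1) ^ u :=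
        sum_le_sum fun A _ => weight_le hrn h𝓕 hint hP hdec (by omega) hcov A
    _ = u.choose t * (starCard n (t + s) k u * (s + 1) ^ u) := by
        rw [sum_const, card_powersetCard, hT, smul_eq_mul]
    _ ≤ _ := hmono u hu
    _ = _ := by ring

/-- If `T` is the only cover of size `t + 1`, the members not containing `T` miss exactly one
`x ∈ T`. Some member contains `x` but not the rest of `T`, so that there are only `s` candidates
for a further element `z` of a member missing `x`, and `T` with `x` replaced by `z` is not a
cover. -/
theorem card_le_of_unique_cover (hrn : t + s ≤ n) (h𝓕 : 𝓕 ⊆ signedSets n (t + s) k)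
    (hint : IsTIntersecting t 𝓕) (hP : (t + 1) * (t + 2) ≤ m)
    (hdec : ∀ j, t + 1 ≤ j →
      (s + 3) * m * starCard n (t + s) k (j + 1) ≤ 2 * starCard n (t + s) k j)
    (hnt : ∀ S, IsSigned S → S.card = t → ∃ F ∈ 𝓕, ¬ S ⊆ F)
    {T : Finset (Fin n × Fin k)} (hTs : IsSigned T) (hT : T.card = t + 1)
    (hTcov : ∀ F ∈ 𝓕, t ≤ (T ∩ F).card)
    (huniq : ∀ S, IsSigned S → S.card = t + 1 → (∀ F ∈ 𝓕, t ≤ (S ∩ F).card) → S = T) :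
    𝓕.card ≤ starCard n (t + s) k (t + 1) +
      (t + 1) * (s * ((s + 1) * starCard n (t + s) k (t + 2))) := by
  have hsub : 𝓕 ⊆ 𝓕.filter (T ⊆ ·) ∪
      T.biUnion fun x => 𝓕.filter fun F => x ∉ F ∧ T.erase x ⊆ F := by
    intro F hF
    by_cases hTF : T ⊆ F
    · exact mem_union_left _ (mem_filter.2 ⟨hF, hTF⟩)
    · obtain ⟨x, hxT, hxF⟩ := not_subset.1 hTF
      refine mem_union_right _ (mem_biUnion.2 ⟨x, hxT, mem_filter.2 ⟨hF, hxF, ?_⟩⟩)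
      have h1 : T ∩ F ⊆ T.erase x := fun y hy =>
        mem_erase.2 ⟨fun h => hxF (h ▸ (mem_inter.1 hy).2), (mem_inter.1 hy).1⟩
      rw [← eq_of_subset_of_card_le h1 (by rw [card_erase_of_mem hxT, hT]; exact hTcov F hF)]
      exact inter_subset_right
  have hclass : ∀ x ∈ T, (𝓕.filter fun F => x ∉ F ∧ T.erase x ⊆ F).card ≤
      s * ((s + 1) * starCard n (t + s) k (t + 2)) := by
    intro x hxT
    have hSc : (T.erase x).card = t := by rw [card_erase_of_mem hxT, hT]; rfl
    obtain ⟨F', hF', hSF'⟩ := hnt (T.erase x) (hTs.mono (erase_subset _ _)) hSc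
    have hxF' : x ∈ F' := by
      by_contra hx
      have h1 : T ∩ F' ⊆ T.erase x := fun y hy =>
        mem_erase.2 ⟨fun h => hx (h ▸ (mem_inter.1 hy).2), (mem_inter.1 hy).1⟩
      rw [← eq_of_subset_of_card_le h1 (by rw [hSc]; exact hTcov F' hF')] at hSF'
      exact hSF' inter_subset_right
    have hSlt : (T.erase x ∩ F').card < t := by
      rw [← hSc]
      exact card_lt_card ⟨inter_subset_left, fun h => hSF' (h.trans inter_subset_right)⟩
    have hF'T : (F' \ T).card ≤ s := by
      have h1 := card_sdiff_add_card_inter F' T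
      rw [(mem_signedSets.1 (h𝓕 hF')).1, inter_comm] at h1
      have := hTcov F' hF'
      omega
    refine (card_le_card (t := (F' \ T).biUnion fun z => 𝓕.filter (insert z (T.erase x) ⊆ ·))
      ?_).trans ((card_biUnion_le_card_mul _ _ _ fun z hz => ?_).trans
        (Nat.mul_le_mul_right _ hF'T))
    · intro F hF
      obtain ⟨hF, hxF, hSF⟩ := mem_filter.1 hF
      have h1 : ¬ F ∩ F' ⊆ T.erase x ∩ F' := fun h => by
        have := card_le_card h
        have := hint F hF F' hF'
        omega
      obtain ⟨z, hz, hzS⟩ := not_subset.1 h1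
      obtain ⟨hzF, hzF'⟩ := mem_inter.1 hz
      refine mem_biUnion.2 ⟨z, mem_sdiff.2 ⟨hzF', fun hzT => hzS (mem_inter.2 ⟨mem_erase.2
        ⟨fun h => hxF (h ▸ hzF), hzT⟩, hzF'⟩)⟩, mem_filter.2 ⟨hF, insert_subset hzF hSF⟩⟩
    · have hzT := (mem_sdiff.1 hz).2
      have hc : (insert z (T.erase x)).card = t + 1 := by
        rw [card_insert_of_notMem fun h => hzT (mem_erase.1 h).2, hSc]
      refine card_superset_le_of_not_cover hrn h𝓕 hint hP hdec hc fun hs => ?_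
      by_contra! h
      exact hzT (huniq _ hs hc h ▸ mem_insert_self _ _)
  refine (card_le_card hsub).trans ((card_union_le _ _).trans (Nat.add_le_add ?_ ?_))
  · exact hT ▸ card_filter_superset_le hrn h𝓕 T
  · exact hT ▸ card_biUnion_le_card_mul _ _ _ hclass

/-- The bound when the covers of size `t + 1` are the sets `X ∪ {y}` with `y ∈ Y`. The members
containing `X` meet a fixed member not containing `X` in one of `s + 1` elements; the other
members contain `Y` and all but one element of `X`. -/
theorem card_le_of_sunflower (hrn : t + s ≤ n) (h𝓕 : 𝓕 ⊆ signedSets n (t + s) k)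
    (hint : IsTIntersecting t 𝓕) (hP : (t + 1) * (t + 2) ≤ m)
    (hdec : ∀ j, t + 1 ≤ j →
      (s + 3) * m * starCard n (t + s) k (j + 1) ≤ 2 * starCard n (t + s) k j)
    {X Y : Finset (Fin n × Fin k)} (hX : X.card = t) (hXY : Disjoint X Y) (hY : 2 ≤ Y.card)
    (hcov : ∀ S, IsSigned S → S.card = t + 1 → (∀ F ∈ 𝓕, t ≤ (S ∩ F).card) →
      ∃ y ∈ Y, S = insert y X)
    {F₂ : Finset (Fin n × Fin k)} (hF₂ : F₂ ∈ 𝓕) (hXF₂ : ¬ X ⊆ F₂)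
    (hout : ∀ F ∈ 𝓕, ¬ X ⊆ F → Y ⊆ F ∧ ∃ x ∈ X, x ∉ F ∧ X.erase x ⊆ F) :
    𝓕.card ≤ Y.card * starCard n (t + s) k (t + 1) +
      (s + 1 - Y.card) * ((s + 1) * starCard n (t + s) k (t + 2)) +
      t * ((if Y.card = 2 then s + 1 else 1) * starCard n (t + s) k (t + 2)) := by
  have hF₂c := (mem_signedSets.1 (h𝓕 hF₂)).1
  obtain ⟨hYF₂, x₂, hx₂X, hx₂F, hx₂⟩ := hout F₂ hF₂ hXF₂
  have hinter : X ∩ F₂ = X.erase x₂ := by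
    ext y
    rw [mem_inter, mem_erase]
    refine ⟨fun h => ⟨fun hy => hx₂F (hy ▸ h.2), h.1⟩, fun h => ⟨h.2, hx₂ (mem_erase.2 h)⟩⟩
  have htpos : 0 < t := hX ▸ card_pos.2 ⟨x₂, hx₂X⟩
  have hWc : (F₂ \ X).card = s + 1 := by
    have h1 := card_sdiff_add_card_inter F₂ X
    rw [inter_comm, hinter, card_erase_of_mem hx₂X, hX, hF₂c] at h1
    omega
  have hYW : Y ⊆ F₂ \ X := fun y hy => mem_sdiff.2 ⟨hYF₂ hy, disjoint_right.1 hXY hy⟩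
  have hinsc : ∀ z, z ∉ X → (insert z X).card = t + 1 := fun z hz => by
    rw [card_insert_of_notMem hz, hX]
  have hsub : 𝓕 ⊆ (Y.biUnion (fun z => 𝓕.filter (insert z X ⊆ ·)) ∪
      ((F₂ \ X) \ Y).biUnion fun z => 𝓕.filter (insert z X ⊆ ·)) ∪
      X.biUnion fun x => 𝓕.filter (X.erase x ∪ Y ⊆ ·) := by
    intro F hF
    by_cases hXF : X ⊆ F
    · refine mem_union_left _ ?_
      have h1 : ¬ F ∩ F₂ ⊆ X ∩ F₂ := fun h => by
        have h2 := card_le_card h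
        rw [hinter, card_erase_of_mem hx₂X, hX] at h2
        have := hint F hF F₂ hF₂
        omega
      obtain ⟨z, hz, hzX⟩ := not_subset.1 h1
      obtain ⟨hzF, hzF₂⟩ := mem_inter.1 hz
      have hzX : z ∉ X := fun h => hzX (mem_inter.2 ⟨h, hzF₂⟩)
      have hmem := mem_filter.2 ⟨hF, insert_subset hzF hXF⟩
      by_cases hzY : z ∈ Y
      · exact mem_union_left _ (mem_biUnion.2 ⟨z, hzY, hmem⟩)
      · exact mem_union_right _ (mem_biUnion.2
          ⟨z, mem_sdiff.2 ⟨mem_sdiff.2 ⟨hzF₂, hzX⟩, hzY⟩, hmem⟩)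
    · obtain ⟨hYF, x, hxX, -, hx⟩ := hout F hF hXF
      exact mem_union_right _ (mem_biUnion.2 ⟨x, hxX, mem_filter.2 ⟨hF, union_subset hx hYF⟩⟩)
  refine (card_le_card hsub).trans ((card_union_le _ _).trans (Nat.add_le_add
    ((card_union_le _ _).trans (Nat.add_le_add ?_ ?_)) ?_))
  · refine card_biUnion_le_card_mul _ _ _ fun z hz => ?_
    rw [← hinsc z (disjoint_right.1 hXY hz)]
    exact card_filter_superset_le hrn h𝓕 _
  · rw [← hWc, ← card_sdiff_of_subset hYW, hWc]
    refine card_biUnion_le_card_mul _ _ _ fun z hz => ?_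
    obtain ⟨hz, hzY⟩ := mem_sdiff.1 hz
    have hzX := (mem_sdiff.1 hz).2
    refine card_superset_le_of_not_cover hrn h𝓕 hint hP hdec (hinsc z hzX) fun hs => ?_
    by_contra! h
    obtain ⟨y, hy, hzy⟩ := hcov _ hs (hinsc z hzX) h
    have : z ∈ insert y X := hzy ▸ mem_insert_self z X
    rcases mem_insert.1 this with h1 | h1
    · exact hzY (h1 ▸ hy)
    · exact hzX h1
  · conv_rhs => rw [← hX]
    refine card_biUnion_le_card_mul _ _ _ fun x hx => ?_
    have hc : (X.erase x ∪ Y).card = t - 1 + Y.card := by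
      rw [card_union_of_disjoint (disjoint_of_subset_left (erase_subset _ _) hXY),
        card_erase_of_mem hx, hX]
    split_ifs with hY2
    · refine (card_superset_le_of_not_cover hrn h𝓕 hint hP hdec (by omega) fun hs => ?_).trans_eq
        (by rw [hX])
      by_contra! h
      obtain ⟨y, hy, hxy⟩ := hcov _ hs (by omega) h
      have : x ∈ X.erase x ∪ Y := hxy ▸ mem_insert_of_mem hx
      rcases mem_union.1 this with h1 | h1
      · exact (mem_erase.1 h1).1 rfl
      · exact disjoint_left.1 hXY hx h1
    · rw [hX, one_mul]
      have h1 := weight_le_of_card_le hrn h𝓕 hP hdec (u := t + 2) (by omega)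
        (S := X.erase x ∪ Y) (by omega)
      refine Nat.le_of_mul_le_mul_right (h1.trans' (Nat.mul_le_mul_left _ ?_))
        (pow_pos (Nat.succ_pos s) (t + 2))
      exact Nat.pow_le_pow_right (Nat.succ_pos s) (by omega)

end Bounds

/-! ### Structure of maximal families with a cover of size `t + 1` -/

theorem card_inter_add_card_inter_le {α : Type*} [DecidableEq α] (A B E : Finset α) :
    (A ∩ E).card + (B ∩ E).card ≤ (A ∩ B).card + E.card := by
  rw [← card_union_add_card_inter (A ∩ E), add_comm]
  refine Nat.add_le_add (card_le_card fun x hx => ?_)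
    (card_le_card (union_subset inter_subset_right inter_subset_right))
  simp only [mem_inter] at hx ⊢
  exact ⟨hx.1.1, hx.2.1⟩

theorem erase_subset_of_card_inter {α : Type*} [DecidableEq α] {T F : Finset α} {x : α} {t : ℕ}
    (hT : T.card ≤ t + 1) (hx : x ∈ T) (hxF : x ∉ F) (h : t ≤ (T ∩ F).card) : T.erase x ⊆ F := by
  have h1 : T ∩ F ⊆ T.erase x := fun y hy =>
    mem_erase.2 ⟨fun h => hxF (h ▸ (mem_inter.1 hy).2), (mem_inter.1 hy).1⟩
  rw [← eq_of_subset_of_card_le h1 (by rw [card_erase_of_mem hx]; omega)]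
  exact inter_subset_right

theorem isTIntersecting_filter {r t : ℕ} {Z : Finset (Fin n × Fin k)} (hZ : Z.card = t + 2) :
    IsTIntersecting t ((signedSets n r k).filter fun F => t + 1 ≤ (F ∩ Z).card) := by
  intro F hF F' hF'
  have := (mem_filter.1 hF).2
  have := (mem_filter.1 hF').2
  have := card_inter_add_card_inter_le F F' Z
  omega

theorem isTIntersecting_familyOne {r l t : ℕ} {X E : Finset (Fin n × Fin k)} (hX : X.card = t)
    (hE : E.card = l) (hl : t + 2 ≤ l) : IsTIntersecting t (familyOne n r k l t X E) := by
  intro F hF F' hF'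
  have hc := card_inter_add_card_inter_le F F' E
  rcases (mem_filter.1 hF).2 with ⟨h1, h2⟩ | ⟨h1, h2⟩ <;>
    rcases (mem_filter.1 hF').2 with ⟨h3, h4⟩ | ⟨h3, h4⟩
  · exact hX ▸ card_le_card (subset_inter h1 h3)
  all_goals omega

theorem isTIntersecting_familyTwo {r t : ℕ} {X E Z : Finset (Fin n × Fin k)} (hX : X.card = t)
    (hXE : X ⊆ E) (hE : E.card = r) (hr : t + 2 ≤ r) :
    IsTIntersecting t (familyTwo n r k t X E Z) := by
  -- the pair of a set of the second kind and a set of the third kind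
  have hmixed : ∀ F F' : Finset (Fin n × Fin k), F ∩ E = X → Z \ E ⊆ F →
      (F' ∩ E).card = r - 1 → (F' ∩ (Z \ E)).card = 1 → t ≤ (F ∩ F').card := by
    intro F F' h1 h2 h3 h4
    obtain ⟨w, hw⟩ := card_pos.1 (by omega : 0 < (F' ∩ (Z \ E)).card)
    obtain ⟨hwF', hwZ⟩ := mem_inter.1 hw
    have hc := card_inter_add_card_inter_le X F' E
    rw [inter_eq_left.2 hXE] at hc
    have hins : insert w (X ∩ F') ⊆ F ∩ F' :=
      insert_subset (mem_inter.2 ⟨h2 hwZ, hwF'⟩)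
        (inter_subset_inter_right (h1 ▸ inter_subset_left))
    have := card_le_card hins
    rw [card_insert_of_notMem fun h => (mem_sdiff.1 hwZ).2 (hXE (mem_inter.1 h).1)] at this
    omega
  intro F hF F' hF'
  have hc := card_inter_add_card_inter_le F F' E
  have hsub : ∀ {G : Finset (Fin n × Fin k)}, G ∩ E = X → X ⊆ G := fun h => h ▸ inter_subset_left
  rcases (mem_filter.1 hF).2 with ⟨h1, h2⟩ | ⟨h1, h2⟩ | ⟨h1, h2, h2'⟩ <;>
    rcases (mem_filter.1 hF').2 with ⟨h3, h4⟩ | ⟨h3, h4⟩ | ⟨h3, h4, h4'⟩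
  · exact hX ▸ card_le_card (subset_inter h1 h3)
  · exact hX ▸ card_le_card (subset_inter h1 (hsub h3))
  · omega
  · exact hX ▸ card_le_card (subset_inter (hsub h1) h3)
  · exact hX ▸ card_le_card (subset_inter (hsub h1) (hsub h3))
  · exact hmixed F F' h1 h2 h4 h4'
  · omega
  · rw [inter_comm]
    exact hmixed F' F h3 h4 h2 h2'
  · omega

section Maximal

variable {t s : ℕ} {𝓕 : Finset (Finset (Fin n × Fin k))}

theorem eq_of_subset_of_maximal {r : ℕ} (hmax : Maximal (IsNontrivialTIntersecting n r k t) 𝓕)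
    {𝓖 : Finset (Finset (Fin n × Fin k))} (h𝓖 : 𝓖 ⊆ signedSets n r k)
    (hint : IsTIntersecting t 𝓖) (h : 𝓕 ⊆ 𝓖) : 𝓕 = 𝓖 :=
  hmax.eq_of_le ⟨h𝓖, hint, fun ⟨T, hT, hTF⟩ => hmax.prop.2.2 ⟨T, hT, fun F hF => hTF F (h hF)⟩⟩ h

theorem exists_not_subset_of_maximal {r : ℕ}
    (hmax : Maximal (IsNontrivialTIntersecting n r k t) 𝓕)
    {S : Finset (Fin n × Fin k)} (hS : IsSigned S) (hSc : S.card = t) : ∃ F ∈ 𝓕, ¬ S ⊆ F := by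
  by_contra! h
  exact hmax.prop.2.2 ⟨S, mem_signedSets.2 ⟨hSc, hS⟩, h⟩

theorem mem_of_superset_cover (hmax : Maximal (IsNontrivialTIntersecting n (t + s) k t) 𝓕)
    {T F : Finset (Fin n × Fin k)} (hcov : ∀ G ∈ 𝓕, t ≤ (T ∩ G).card)
    (hF : F ∈ signedSets n (t + s) k) (hTF : T ⊆ F) : F ∈ 𝓕 := by
  have hFG : ∀ G ∈ 𝓕, t ≤ (F ∩ G).card := fun G hG =>
    (hcov G hG).trans (card_le_card (inter_subset_inter_right hTF))
  rw [eq_of_subset_of_maximal hmax (𝓖 := insert F 𝓕) (insert_subset hF hmax.prop.1) ?_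
    (subset_insert _ _)]
  · exact mem_insert_self _ _
  · intro A hA B hB
    rcases mem_insert.1 hA with rfl | hA' <;> rcases mem_insert.1 hB with rfl | hB'
    · rw [inter_self, (mem_signedSets.1 hF).1]
      omega
    · exact hFG _ hB'
    · rw [inter_comm]
      exact hFG _ hA'
    · exact hmax.prop.2.1 _ hA' _ hB'

/-- A member containing the cover `T` can be chosen to avoid the elements of `T' \ T`; it meets
`T'` in at least `t` elements. -/
theorem le_card_inter_of_covers (hk : 2 ≤ k) (hs : 1 ≤ s) (hrn : t + s ≤ n)
    (hmax : Maximal (IsNontrivialTIntersecting n (t + s) k t) 𝓕)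
    {T T' : Finset (Fin n × Fin k)} (hT : IsSigned T) (hTc : T.card = t + 1)
    (hcov : ∀ G ∈ 𝓕, t ≤ (T ∩ G).card) (hT' : IsSigned T') (hcov' : ∀ G ∈ 𝓕, t ≤ (T' ∩ G).card) :
    t ≤ (T ∩ T').card := by
  obtain ⟨F, hF, hTF, hFT⟩ := exists_superset_avoiding hk hrn hT (by omega) hT'
  refine (hcov' F (mem_of_superset_cover hmax hcov hF hTF)).trans (card_le_card fun x hx => ?_)
  obtain ⟨h1, h2⟩ := mem_inter.1 hx
  exact mem_inter.2 ⟨hFT (mem_inter.2 ⟨h2, h1⟩), h1⟩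

/-- Three covers of size `t + 1` without `t` common elements are subsets of a signed set `Z` of size
`t + 2`, and every member of the family contains all but one element of `Z`. -/
theorem eq_filter_of_three_covers
    (hmax : Maximal (IsNontrivialTIntersecting n (t + s) k t) 𝓕)
    {T₀ T₁ T₂ : Finset (Fin n × Fin k)} (hT₀ : IsSigned T₀) (hT₁ : IsSigned T₁)
    (hT₂ : IsSigned T₂) (hc₀ : T₀.card = t + 1) (hc₁ : T₁.card = t + 1) (hc₂ : T₂.card = t + 1)
    (hcov₀ : ∀ G ∈ 𝓕, t ≤ (T₀ ∩ G).card) (hcov₁ : ∀ G ∈ 𝓕, t ≤ (T₁ ∩ G).card)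
    (hcov₂ : ∀ G ∈ 𝓕, t ≤ (T₂ ∩ G).card) (h₀₁ : (T₀ ∩ T₁).card = t)
    (h₀₂ : t ≤ (T₀ ∩ T₂).card) (h₁₂ : t ≤ (T₁ ∩ T₂).card) (hX : ¬ T₀ ∩ T₁ ⊆ T₂) :
    ∃ X Z : Finset (Fin n × Fin k), X ⊆ Z ∧ X.card = t ∧ Z.card = t + 2 ∧ IsSigned Z ∧
      𝓕 = (signedSets n (t + s) k).filter fun F => t + 1 ≤ (F ∩ Z).card := by
  obtain ⟨x, hxX, hx₂⟩ := not_subset.1 hX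
  obtain ⟨hx₀, hx₁⟩ := mem_inter.1 hxX
  have hsub₀ := erase_subset_of_card_inter hc₀.le hx₀ hx₂ h₀₂
  have hsub₁ := erase_subset_of_card_inter hc₁.le hx₁ hx₂ h₁₂
  have hZc : (T₀ ∪ T₁).card = t + 2 := by
    have := card_union_add_card_inter T₀ T₁
    omega
  have hsub : (T₀ ∪ T₁).erase x ⊆ T₂ := by
    intro y hy
    obtain ⟨hyx, hy⟩ := mem_erase.1 hy
    rcases mem_union.1 hy with h | h
    · exact hsub₀ (mem_erase.2 ⟨hyx, h⟩)
    · exact hsub₁ (mem_erase.2 ⟨hyx, h⟩)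
  have hT₂Z : (T₀ ∪ T₁).erase x = T₂ := eq_of_subset_of_card_le hsub (by
    rw [card_erase_of_mem (mem_union_left _ hx₀), hZc, hc₂]
    omega)
  refine ⟨T₀ ∩ T₁, T₀ ∪ T₁, inter_subset_left.trans subset_union_left, h₀₁, hZc, ?_, ?_⟩
  · have hsx : ∀ q ∈ T₀ ∪ T₁, x.1 = q.1 → x = q := by
      intro q hq hxq
      rcases mem_union.1 hq with h | h
      · exact hT₀ x hx₀ q h hxq
      · exact hT₁ x hx₁ q h hxq
    intro p hp q hq hpq
    by_cases hpx : p = x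
    · subst hpx
      exact hsx q hq hpq
    · by_cases hqx : q = x
      · subst hqx
        exact (hsx p hp hpq.symm).symm
      · exact hT₂ p (hsub (mem_erase.2 ⟨hpx, hp⟩)) q (hsub (mem_erase.2 ⟨hqx, hq⟩)) hpq
  · refine eq_of_subset_of_maximal hmax (filter_subset _ _) (isTIntersecting_filter hZc)
      fun F hF => mem_filter.2 ⟨hmax.prop.1 hF, ?_⟩
    by_contra! hlt
    have heq : ∀ T ⊆ T₀ ∪ T₁, t ≤ (T ∩ F).card → F ∩ (T₀ ∪ T₁) ⊆ T := by
      intro T hTZ hT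
      rw [← eq_of_subset_of_card_le (s := T ∩ F) (t := F ∩ (T₀ ∪ T₁))
        (fun y hy => mem_inter.2 ⟨(mem_inter.1 hy).2, hTZ (mem_inter.1 hy).1⟩) (by omega)]
      exact inter_subset_left
    have h₀ := heq T₀ subset_union_left (hcov₀ F hF)
    have h₁ := heq T₁ subset_union_right (hcov₁ F hF)
    have h₂ := heq T₂ (hT₂Z ▸ erase_subset _ _) (hcov₂ F hF)
    have hle : T₀ ∩ F ⊆ (T₀ ∩ T₁).erase x := by
      intro y hy
      have hy' : y ∈ F ∩ (T₀ ∪ T₁) :=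
        mem_inter.2 ⟨(mem_inter.1 hy).2, mem_union_left _ (mem_inter.1 hy).1⟩
      exact mem_erase.2 ⟨fun h => hx₂ (h ▸ h₂ hy'), mem_inter.2 ⟨h₀ hy', h₁ hy'⟩⟩
    have h3 := card_le_card hle
    have h4 := hcov₀ F hF
    have h5 := card_pos.2 ⟨x, hxX⟩
    rw [card_erase_of_mem hxX] at h3
    omega

/-- If all covers of size `t + 1`, at least two in number, contain a common set `X` of size `t`,
they are the sets `X ∪ {y}` with `y` in a set `Y`, and a member of the family that does not contain
`X` contains `Y` and all but one element of `X`. Such members exist, hence `X ∪ Y` is signed. -/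
theorem exists_sunflower
    (hmax : Maximal (IsNontrivialTIntersecting n (t + s) k t) 𝓕)
    {T₀ T₁ : Finset (Fin n × Fin k)} (hT₀ : IsSigned T₀) (hT₁ : IsSigned T₁)
    (hc₀ : T₀.card = t + 1) (hc₁ : T₁.card = t + 1) (hcov₀ : ∀ G ∈ 𝓕, t ≤ (T₀ ∩ G).card)
    (hcov₁ : ∀ G ∈ 𝓕, t ≤ (T₁ ∩ G).card) (h₀₁ : (T₀ ∩ T₁).card = t)
    (hX : ∀ S, IsSigned S → S.card = t + 1 → (∀ F ∈ 𝓕, t ≤ (S ∩ F).card) → T₀ ∩ T₁ ⊆ S) :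
    ∃ X Y : Finset (Fin n × Fin k), X.card = t ∧ Disjoint X Y ∧ IsSigned (X ∪ Y) ∧ 2 ≤ Y.card ∧
      (∀ S, IsSigned S → S.card = t + 1 → (∀ F ∈ 𝓕, t ≤ (S ∩ F).card) →
        ∃ y ∈ Y, S = insert y X) ∧
      ∀ F ∈ 𝓕, ¬ X ⊆ F → Y ⊆ F ∧ ∃ x ∈ X, x ∉ F ∧ X.erase x ⊆ F := by
  classical
  set X := T₀ ∩ T₁ with hXdef
  set Y : Finset (Fin n × Fin k) := univ.filter fun y => y ∉ X ∧ IsSigned (insert y X) ∧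
    ∀ F ∈ 𝓕, t ≤ (insert y X ∩ F).card with hYdef
  have hY : ∀ y, y ∈ Y ↔ y ∉ X ∧ IsSigned (insert y X) ∧
    ∀ F ∈ 𝓕, t ≤ (insert y X ∩ F).card := fun y => by simp [hYdef]
  have hXY : Disjoint X Y := disjoint_right.2 fun y hy => ((hY y).1 hy).1
  have hcov : ∀ S, IsSigned S → S.card = t + 1 → (∀ F ∈ 𝓕, t ≤ (S ∩ F).card) →
      ∃ y ∈ Y, S = insert y X := by
    intro S hS hSc hScov
    have hXS := hX S hS hSc hScov
    obtain ⟨y, hy⟩ := card_eq_one.1 (show (S \ X).card = 1 by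
      rw [card_sdiff_of_subset hXS]
      omega)
    have hSy : S = insert y X := by
      rw [← sdiff_union_of_subset hXS, hy]
      rfl
    have hyX : y ∉ X := (mem_sdiff.1 (hy ▸ mem_singleton_self y : y ∈ S \ X)).2
    exact ⟨y, (hY y).2 ⟨hyX, hSy ▸ hS, hSy ▸ hScov⟩, hSy⟩
  obtain ⟨y₀, hy₀, hT₀y⟩ := hcov T₀ hT₀ hc₀ hcov₀
  obtain ⟨y₁, hy₁, hT₁y⟩ := hcov T₁ hT₁ hc₁ hcov₁
  have hne : y₀ ≠ y₁ := by
    rintro rfl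
    rw [← hT₁y] at hT₀y
    rw [hXdef, hT₀y, inter_self] at h₀₁
    omega
  have hout : ∀ F ∈ 𝓕, ¬ X ⊆ F → Y ⊆ F ∧ ∃ x ∈ X, x ∉ F ∧ X.erase x ⊆ F := by
    intro F hF hXF
    obtain ⟨x, hxX, hxF⟩ := not_subset.1 hXF
    have key : ∀ y ∈ Y, (insert y X).erase x ⊆ F := fun y hy =>
      erase_subset_of_card_inter (by rw [card_insert_of_notMem ((hY y).1 hy).1, h₀₁])
        (mem_insert_of_mem hxX) hxF (((hY y).1 hy).2.2 F hF)
    refine ⟨fun y hy => key y hy (mem_erase.2 ⟨?_, mem_insert_self _ _⟩), x, hxX, hxF,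
      (erase_subset_erase _ (subset_insert _ _)).trans (key y₀ hy₀)⟩
    rintro rfl
    exact disjoint_left.1 hXY hxX hy
  obtain ⟨F₂, hF₂, hXF₂⟩ := exists_not_subset_of_maximal hmax (hT₀.mono inter_subset_left) h₀₁
  have hYF₂ := (hout F₂ hF₂ hXF₂).1
  refine ⟨X, Y, h₀₁, hXY, ?_, ?_, hcov, hout⟩
  · intro p hp q hq hpq
    rcases mem_union.1 hp with h | h <;> rcases mem_union.1 hq with h' | h'
    · exact hT₀ p (mem_inter.1 h).1 q (mem_inter.1 h').1 hpq
    · exact ((hY q).1 h').2.1 p (mem_insert_of_mem h) q (mem_insert_self _ _) hpq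
    · exact ((hY p).1 h).2.1 p (mem_insert_self _ _) q (mem_insert_of_mem h') hpq
    · exact (mem_signedSets.1 (hmax.prop.1 hF₂)).2 p (hYF₂ h) q (hYF₂ h') hpq
  · rw [← card_pair hne]
    exact card_le_card (insert_subset hy₀ (singleton_subset_iff.2 hy₁))

theorem inter_union_eq_erase {X Y F : Finset (Fin n × Fin k)} {x : Fin n × Fin k}
    (hY : Y ⊆ F) (hxF : x ∉ F) (hX : X.erase x ⊆ F) :
    F ∩ (X ∪ Y) = (X ∪ Y).erase x := by
  ext y
  rw [mem_inter, mem_erase]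
  refine ⟨fun h => ⟨fun hyx => hxF (hyx ▸ h.1), h.2⟩, fun ⟨hyx, h⟩ => ⟨?_, h⟩⟩
  rcases mem_union.1 h with h | h
  · exact hX (mem_erase.2 ⟨hyx, h⟩)
  · exact hY h

theorem eq_familyOne_of_sunflower
    (hmax : Maximal (IsNontrivialTIntersecting n (t + s) k t) 𝓕)
    {X Y : Finset (Fin n × Fin k)} (hX : X.card = t) (hXY : Disjoint X Y) (hY : 2 ≤ Y.card)
    (hout : ∀ F ∈ 𝓕, ¬ X ⊆ F → Y ⊆ F ∧ ∃ x ∈ X, x ∉ F ∧ X.erase x ⊆ F)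
    (hin : ∀ F ∈ 𝓕, X ⊆ F → t + 1 ≤ (F ∩ (X ∪ Y)).card) :
    𝓕 = familyOne n (t + s) k (t + Y.card) t X (X ∪ Y) := by
  have hE : (X ∪ Y).card = t + Y.card := by rw [card_union_of_disjoint hXY, hX]
  refine eq_of_subset_of_maximal hmax (filter_subset _ _)
    (isTIntersecting_familyOne hX hE (by omega)) fun F hF =>
    mem_filter.2 ⟨hmax.prop.1 hF, ?_⟩
  by_cases hXF : X ⊆ F
  · exact Or.inl ⟨hXF, hin F hF hXF⟩
  · obtain ⟨hYF, x, hxX, hxF, hx⟩ := hout F hF hXF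
    refine Or.inr ⟨hXF, ?_⟩
    rw [inter_union_eq_erase hYF hxF hx, card_erase_of_mem (mem_union_left _ hxX), hE]

/-- A sunflower with `s + 1` petals: the members not containing `X` are subsets of `X ∪ Y`. -/
theorem le_card_inter_of_card_eq_add_one
    (hmax : Maximal (IsNontrivialTIntersecting n (t + s) k t) 𝓕)
    {X Y : Finset (Fin n × Fin k)} (hX : X.card = t) (hXY : Disjoint X Y) (hY : Y.card = s + 1)
    (hXs : IsSigned X)
    (hout : ∀ F ∈ 𝓕, ¬ X ⊆ F → Y ⊆ F ∧ ∃ x ∈ X, x ∉ F ∧ X.erase x ⊆ F) :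
    ∀ F ∈ 𝓕, X ⊆ F → t + 1 ≤ (F ∩ (X ∪ Y)).card := by
  intro F hF hXF
  obtain ⟨F₂, hF₂, hXF₂⟩ := exists_not_subset_of_maximal hmax hXs hX
  obtain ⟨hYF₂, x, hxX, hxF₂, hx⟩ := hout F₂ hF₂ hXF₂
  have heq := inter_union_eq_erase hYF₂ hxF₂ hx
  have hF₂E : F₂ ⊆ X ∪ Y := by
    rw [← inter_eq_left]
    refine eq_of_subset_of_card_le inter_subset_left ?_
    rw [heq, card_erase_of_mem (mem_union_left _ hxX), card_union_of_disjoint hXY, hX, hY,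
      (mem_signedSets.1 (hmax.prop.1 hF₂)).1]
    omega
  have hsub : insert x (F ∩ F₂) ⊆ F ∩ (X ∪ Y) :=
    insert_subset (mem_inter.2 ⟨hXF hxX, mem_union_left _ hxX⟩)
      (inter_subset_inter_left hF₂E)
  have h1 := card_le_card hsub
  rw [card_insert_of_notMem fun h => hxF₂ (mem_inter.1 h).2] at h1
  have := hmax.prop.2.1 F hF F₂ hF₂
  omega

/-- A sunflower with `s` petals, when some member `G` meets `E = X ∪ Y` exactly in `X`. A member not
containing `X` has exactly one element outside `E`; these elements form a set `W`, and `G` has to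
contain `W`. -/
theorem eq_familyTwo_of_sunflower (hs : 2 ≤ s)
    (hmax : Maximal (IsNontrivialTIntersecting n (t + s) k t) 𝓕)
    {X Y : Finset (Fin n × Fin k)} (hX : X.card = t) (hXY : Disjoint X Y) (hY : Y.card = s)
    (hsig : IsSigned (X ∪ Y))
    (hcov : ∀ S, IsSigned S → S.card = t + 1 → (∀ F ∈ 𝓕, t ≤ (S ∩ F).card) →
      ∃ y ∈ Y, S = insert y X)
    (hout : ∀ F ∈ 𝓕, ¬ X ⊆ F → Y ⊆ F ∧ ∃ x ∈ X, x ∉ F ∧ X.erase x ⊆ F)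
    {G : Finset (Fin n × Fin k)} (hG : G ∈ 𝓕) (hXG : X ⊆ G) (hGE : (G ∩ (X ∪ Y)).card < t + 1) :
    ∃ Z : Finset (Fin n × Fin k), X ∪ Y ⊆ Z ∧ IsSigned Z ∧ t + s + 2 ≤ Z.card ∧
      Z.card ≤ t + 2 * s ∧ 𝓕 = familyTwo n (t + s) k t X (X ∪ Y) Z := by
  classical
  set E := X ∪ Y with hEdef
  have hXE : X ⊆ E := subset_union_left
  have hE : E.card = t + s := by rw [hEdef, card_union_of_disjoint hXY, hX, hY]
  set W : Finset (Fin n × Fin k) :=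
    univ.filter fun w => w ∉ E ∧ ∃ F ∈ 𝓕, ¬ X ⊆ F ∧ w ∈ F with hWdef
  have hW : ∀ w, w ∈ W ↔ w ∉ E ∧ ∃ F ∈ 𝓕, ¬ X ⊆ F ∧ w ∈ F := fun w => by simp [hWdef]
  have hEW : Disjoint E W := disjoint_right.2 fun w hw => ((hW w).1 hw).1
  have hFE : ∀ F ∈ 𝓕, ¬ X ⊆ F → (F ∩ E).card = t + s - 1 := by
    intro F hF hXF
    obtain ⟨hYF, x, hxX, hxF, hx⟩ := hout F hF hXF
    rw [inter_union_eq_erase hYF hxF hx, card_erase_of_mem (hXE hxX), hE]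
  have hFW : ∀ F ∈ 𝓕, ¬ X ⊆ F → (F ∩ W).card = 1 := by
    intro F hF hXF
    have h1 : F ∩ W = F \ E := by
      ext w
      rw [mem_inter, mem_sdiff, hW]
      exact ⟨fun h => ⟨h.1, h.2.1⟩, fun h => ⟨h.1, h.2, F, hF, hXF, h.1⟩⟩
    have h2 := card_sdiff_add_card_inter F E
    rw [hFE F hF hXF, (mem_signedSets.1 (hmax.prop.1 hF)).1] at h2
    rw [h1]
    omega
  have hGW : ∀ G ∈ 𝓕, X ⊆ G → (G ∩ E).card < t + 1 → G ∩ E = X ∧ W ⊆ G := by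
    intro G hG hXG hGE
    have hGX : G ∩ E = X := (eq_of_subset_of_card_le (subset_inter hXG hXE) (by omega)).symm
    refine ⟨hGX, fun w hw => ?_⟩
    obtain ⟨hwE, F, hF, hXF, hwF⟩ := (hW w).1 hw
    obtain ⟨v, hv⟩ := card_eq_one.1 (hFW F hF hXF)
    have hwv : w ∈ F ∩ W := mem_inter.2 ⟨hwF, hw⟩
    obtain ⟨-, x, hxX, hxF, -⟩ := hout F hF hXF
    by_contra hwG
    have hle : G ∩ F ⊆ X.erase x := by
      intro y hy
      obtain ⟨hyG, hyF⟩ := mem_inter.1 hy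
      by_cases hyE : y ∈ E
      · exact mem_erase.2 ⟨fun h => hxF (h ▸ hyF), hGX ▸ mem_inter.2 ⟨hyG, hyE⟩⟩
      · have hyv : y ∈ F ∩ W := mem_inter.2 ⟨hyF, (hW y).2 ⟨hyE, F, hF, hXF, hyF⟩⟩
        rw [hv, mem_singleton] at hyv hwv
        exact absurd (hwv.trans hyv.symm ▸ hyG) hwG
    have h1 := card_le_card hle
    have h2 := hmax.prop.2.1 G hG F hF
    have h3 := card_pos.2 ⟨x, hxX⟩
    rw [card_erase_of_mem hxX] at h1
    omega
  obtain ⟨hGX, hWG⟩ := hGW G hG hXG hGE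
  have hGs := mem_signedSets.1 (hmax.prop.1 hG)
  have hZE : (E ∪ W) \ E = W := by
    rw [union_sdiff_left, sdiff_eq_self_of_disjoint hEW.symm]
  have hmix : ∀ p ∈ E, ∀ q ∈ W, p.1 = q.1 → p = q := by
    intro p hp q hq hpq
    rcases mem_union.1 hp with h | h
    · exact hGs.2 p (hXG h) q (hWG hq) hpq
    · obtain ⟨-, F, hF, hXF, hqF⟩ := (hW q).1 hq
      exact (mem_signedSets.1 (hmax.prop.1 hF)).2 p ((hout F hF hXF).1 h) q hqF hpq
  have hZs : IsSigned (E ∪ W) := by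
    intro p hp q hq hpq
    rcases mem_union.1 hp with h | h <;> rcases mem_union.1 hq with h' | h'
    · exact hsig p h q h' hpq
    · exact hmix p h q h' hpq
    · exact (hmix q h' p h hpq.symm).symm
    · exact hGs.2 p (hWG h) q (hWG h') hpq
  have hWXd : Disjoint X W := disjoint_of_subset_left hXE hEW
  have hWs : W.card ≤ s := by
    have h1 := card_le_card (union_subset hXG hWG)
    rw [card_union_of_disjoint hWXd, hX, hGs.1] at h1
    omega
  obtain ⟨F₂, hF₂, hXF₂⟩ := exists_not_subset_of_maximal hmax (hsig.mono hXE) hX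
  have hW1 : 1 ≤ W.card := by
    rw [← hFW F₂ hF₂ hXF₂]
    exact card_le_card inter_subset_right
  have hW2 : W.card ≠ 1 := by
    -- for `W = {w}` the set `X ∪ {w}` would be a further cover
    intro h
    obtain ⟨w, hw⟩ := card_eq_one.1 h
    have hwW : w ∈ W := hw ▸ mem_singleton_self w
    have hwX : w ∉ X := disjoint_right.1 hWXd hwW
    obtain ⟨y, hy, hyw⟩ := hcov (insert w X)
      (hZs.mono (insert_subset (mem_union_right _ hwW) (hXE.trans subset_union_left)))
      (by rw [card_insert_of_notMem hwX, hX]) (fun F hF => by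
        by_cases hXF : X ⊆ F
        · exact hX ▸ card_le_card (subset_inter (subset_insert _ _) hXF)
        · obtain ⟨-, x, hxX, -, hx⟩ := hout F hF hXF
          have hwF : w ∈ F := by
            obtain ⟨v, hv⟩ := card_pos.1 (by rw [hFW F hF hXF]; exact one_pos : 0 < (F ∩ W).card)
            obtain ⟨hvF, hvW⟩ := mem_inter.1 hv
            rw [hw, mem_singleton] at hvW
            exact hvW ▸ hvF
          have hsub : insert w (X.erase x) ⊆ insert w X ∩ F :=
            subset_inter (insert_subset_insert _ (erase_subset _ _)) (insert_subset hwF hx)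
          have h1 := card_le_card hsub
          rw [card_insert_of_notMem fun h => hwX (mem_erase.1 h).2, card_erase_of_mem hxX, hX]
            at h1
          omega)
    have : w ∈ insert y X := hyw ▸ mem_insert_self _ _
    rcases mem_insert.1 this with h | h
    · exact disjoint_right.1 hEW hwW (h ▸ mem_union_right _ hy)
    · exact hwX h
  have hZc : (E ∪ W).card = t + s + W.card := by rw [card_union_of_disjoint hEW, hE]
  refine ⟨E ∪ W, subset_union_left, hZs, by omega, by omega,
    eq_of_subset_of_maximal hmax (filter_subset _ _)
      (isTIntersecting_familyTwo hX hXE hE (by omega)) fun F hF =>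
      mem_filter.2 ⟨hmax.prop.1 hF, ?_⟩⟩
  rw [hZE]
  by_cases hXF : X ⊆ F
  · rcases le_or_gt (t + 1) (F ∩ E).card with h | h
    · exact Or.inl ⟨hXF, h⟩
    · exact Or.inr (Or.inl (hGW F hF hXF h))
  · exact Or.inr (Or.inr ⟨hXF, hFE F hF hXF, hFW F hF hXF⟩)

end Maximal

/-! ### Families of size at least `f` -/

theorem le_of_g_le {t s : ℕ} (hn : t + 2 ≤ n) (hs : 1 ≤ s) (hg : g n (t + s) t ≤ k) :
    (s - 1) * ((s + 3) * max ((t + 1) * (t + 2)) (s + 1)) ≤ 2 * ((n - t - 1) * k) := by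
  obtain ⟨a, rfl⟩ : ∃ a, s = a + 1 := ⟨s - 1, by omega⟩
  obtain ⟨b, rfl⟩ : ∃ b, n = t + 1 + (b + 1) := ⟨n - (t + 2), by omega⟩
  have hchoose : (2 : ℝ) * ((t + 2).choose 2 : ℝ) = (t + 1) * (t + 2) := by
    have h := two_mul_choose_two (t + 2)
    have h' : ((2 * ((t + 2).choose 2 : ℤ) : ℤ) : ℝ) = (((t + 2 : ℕ) : ℤ) * ((t + 2 : ℕ) - 1) : ℤ) :=
      congrArg _ h
    push_cast at h'
    linarith
  rw [g] at hg
  push_cast at hg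
  rw [show (t : ℝ) + (a + 1) - t + 3 = a + 4 by ring, show (t : ℝ) + (a + 1) - t - 1 = a by ring,
    show (t : ℝ) + (a + 1) - t + 1 = a + 2 by ring,
    show (t : ℝ) + 1 + (b + 1) - t - 1 = b + 1 by ring, div_mul_eq_mul_div,
    div_le_iff₀ (by positivity)] at hg
  have key : ∀ M : ℕ, (M : ℝ) ≤ 2 * max ((t + 2).choose 2 : ℝ) (((a : ℝ) + 2) / 2) →
      (a + 1 - 1) * ((a + 1 + 3) * M) ≤ 2 * ((t + 1 + (b + 1) - t - 1) * k) := by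
    intro M hM
    rw [show t + 1 + (b + 1) - t - 1 = b + 1 by omega, Nat.add_sub_cancel]
    have h1 : ((a : ℝ) + 4) * a * M ≤
        ((a : ℝ) + 4) * a * (2 * max ((t + 2).choose 2 : ℝ) (((a : ℝ) + 2) / 2)) :=
      mul_le_mul_of_nonneg_left hM (by positivity)
    have h2 : (a : ℝ) * ((a + 1 + 3) * M) ≤ 2 * ((b + 1) * k) := by linarith
    exact_mod_cast h2
  rcases max_choice ((t + 1) * (t + 2)) (a + 1 + 1) with h | h <;> rw [h] <;> refine key _ ?_
  · push_cast
    have := le_max_left ((t + 2).choose 2 : ℝ) (((a : ℝ) + 2) / 2)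
    linarith
  · push_cast
    have := le_max_right ((t + 2).choose 2 : ℝ) (((a : ℝ) + 2) / 2)
    linarith

/-- A maximal family of size at least `f` is one of the extremal families. -/
theorem classification {t s m : ℕ} (ht : 1 ≤ t) (hs : 1 ≤ s) (hrn : t + s ≤ n) (hk : 2 ≤ k)
    (hP : (t + 1) * (t + 2) ≤ m) (hQ : s + 1 ≤ m)
    (hdec : ∀ j, t + 1 ≤ j →
      (s + 3) * m * starCard n (t + s) k (j + 1) ≤ 2 * starCard n (t + s) k j)
    {𝓕 : Finset (Finset (Fin n × Fin k))}
    (hmax : Maximal (IsNontrivialTIntersecting n (t + s) k t) 𝓕)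
    (hf : f n (t + s) k (t + s) t ≤ 𝓕.card) :
    (∃ X Z : Finset (Fin n × Fin k), X ⊆ Z ∧ X.card = t ∧ Z.card = t + 2 ∧ IsSigned Z ∧
      𝓕 = (signedSets n (t + s) k).filter fun F => t + 1 ≤ (F ∩ Z).card) ∨
    2 ≤ s ∧ (∃ X E : Finset (Fin n × Fin k), X ⊆ E ∧ X.card = t ∧ IsSigned E ∧
      (E.card = t + s ∨ E.card = t + s + 1) ∧ 𝓕 = familyOne n (t + s) k E.card t X E) ∨
    2 ≤ s ∧ ∃ X E Z : Finset (Fin n × Fin k), X ⊆ E ∧ E ⊆ Z ∧ X.card = t ∧ E.card = t + s ∧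
      IsSigned Z ∧ t + s + 2 ≤ Z.card ∧ Z.card ≤ t + 2 * s ∧
      𝓕 = familyTwo n (t + s) k t X E Z := by
  have h𝓕 := hmax.prop.1
  have hint := hmax.prop.2.1
  rw [f_eq hs] at hf
  have hchoose := two_mul_choose_two s
  have hself : ∀ F ∈ 𝓕, IsSigned F ∧ F.card = t + s ∧ ∀ G ∈ 𝓕, t ≤ (F ∩ G).card := fun F hF =>
    ⟨(mem_signedSets.1 (h𝓕 hF)).2, (mem_signedSets.1 (h𝓕 hF)).1, fun G hG => hint F hF G hG⟩
  have hdec' := hdec (t + 1) le_rfl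
  have hpos : 2 ≤ s → 0 < starCard n (t + s) k (t + 2) := fun h =>
    starCard_pos (by omega) (by omega) hrn
  obtain ⟨F₁, hF₁⟩ : 𝓕.Nonempty := by
    by_contra h
    rw [not_nonempty_iff_eq_empty] at h
    refine hmax.prop.2.2 ⟨M n k t, mem_signedSets.2 ⟨card_M (by omega) (by omega), isSigned_M _⟩, ?_⟩
    simp [h]
  set a := starCard n (t + s) k (t + 1)
  set b := starCard n (t + s) k (t + 2)
  have hq : ((s : ℤ) + 3) * m * b ≤ 2 * a := by exact_mod_cast hdec'
  have hPz : ((t : ℤ) + 1) * (t + 2) ≤ m := by exact_mod_cast hP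
  have hQz : (s : ℤ) + 1 ≤ m := by exact_mod_cast hQ
  by_cases hex : ∃ T, IsSigned T ∧ T.card = t + 1 ∧ ∀ F ∈ 𝓕, t ≤ (T ∩ F).card
  swap
  · -- a smallest cover has at least `t + 2` elements
    exfalso
    have hex' : ∃ u, ∃ T, IsSigned T ∧ T.card = u ∧ ∀ F ∈ 𝓕, t ≤ (T ∩ F).card :=
      ⟨t + s, F₁, hself F₁ hF₁⟩
    classical
    obtain ⟨T, hT, hTc, hTcov⟩ := Nat.find_spec hex'
    have hmin : Nat.find hex' ≤ t + s := Nat.find_min' hex' ⟨F₁, hself F₁ hF₁⟩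
    have hcov : ∀ S, IsSigned S → S.card < Nat.find hex' → ∃ F ∈ 𝓕, (S ∩ F).card < t := by
      intro S hS hSc
      by_contra! h
      exact Nat.find_min hex' hSc ⟨S, hS, rfl, h⟩
    set u := Nat.find hex'
    have hu0 : t ≤ u := hTc ▸ (hTcov F₁ hF₁).trans (card_le_card inter_subset_left)
    have hu1 : u ≠ t := by
      intro h
      obtain ⟨F, hF, hTF⟩ := exists_not_subset_of_maximal hmax hT (hTc.trans h)
      refine hTF ?_
      rw [← inter_eq_left]
      exact eq_of_subset_of_card_le inter_subset_left (by rw [hTc, h]; exact hTcov F hF)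
    have hu2 : u ≠ t + 1 := fun h => hex ⟨T, hT, hTc.trans h, hTcov⟩
    have hle := card_le_of_large_cover hrn h𝓕 hint hP hdec (by omega) hcov hTc hTcov
    have hch : ((t + 2).choose t : ℤ) = (t + 2).choose 2 := by
      exact_mod_cast Nat.choose_symm_add (a := t) (b := 2)
    have hch2 := two_mul_choose_two (t + 2)
    have hs2 : (2 : ℤ) ≤ s := by omega
    have key := mul_lt_of_coeff_lt (by omega) (by exact_mod_cast hpos (by omega))
      (coeff_large_cover hs2 hPz hQz) hq
    have hle' : (𝓕.card : ℤ) ≤ (t + 2).choose t * ((s : ℤ) + 1) ^ 2 * b := by exact_mod_cast hle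
    rw [hch] at hle'
    push_cast at hch2
    have h2 : 2 * (((t + 2).choose 2 : ℤ) * ((s : ℤ) + 1) ^ 2 * b) =
        ((t : ℤ) + 1) * (t + 2) * (s + 1) ^ 2 * b := by
      linear_combination ((s : ℤ) + 1) ^ 2 * b * hch2
    have h3 : 2 * ((s.choose 2 : ℤ) * b) = s * (s - 1) * b := by
      linear_combination (b : ℤ) * hchoose
    linarith
  obtain ⟨T₀, hT₀, hc₀, hcov₀⟩ := hex
  by_cases huniq : ∀ S, IsSigned S → S.card = t + 1 → (∀ F ∈ 𝓕, t ≤ (S ∩ F).card) → S = T₀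
  · exfalso
    have hs2 : 2 ≤ s := by
      -- for `s = 1` the members of the family are covers themselves
      by_contra h
      obtain rfl : s = 1 := by omega
      obtain ⟨S, hST, hSc⟩ := exists_subset_card_eq (s := T₀) (n := t) (by omega)
      obtain ⟨F, hF, hSF⟩ := exists_not_subset_of_maximal hmax (hT₀.mono hST) hSc
      obtain ⟨h1, h2, h3⟩ := hself F hF
      exact hSF (huniq F h1 h2 h3 ▸ hST)
    have hle := card_le_of_unique_cover hrn h𝓕 hint hP hdec
      (fun S => exists_not_subset_of_maximal hmax) hT₀ hc₀ hcov₀ huniq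
    have hs2' : (2 : ℤ) ≤ s := by exact_mod_cast hs2
    have key := mul_lt_of_coeff_lt (by omega) (by exact_mod_cast hpos hs2)
      (coeff_one_cover hs2' (by exact_mod_cast ht) hPz) hq
    have hle' : (𝓕.card : ℤ) ≤ a + (t + 1) * (s * ((s + 1) * b)) := by exact_mod_cast hle
    have h3 : 2 * ((s.choose 2 : ℤ) * b) = s * (s - 1) * b := by
      linear_combination (b : ℤ) * hchoose
    linarith
  push Not at huniq
  obtain ⟨T₁, hT₁, hc₁, hcov₁, hne⟩ := huniq
  have hinter : ∀ {T T' : Finset (Fin n × Fin k)}, IsSigned T → T.card = t + 1 →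
      (∀ F ∈ 𝓕, t ≤ (T ∩ F).card) → IsSigned T' → (∀ F ∈ 𝓕, t ≤ (T' ∩ F).card) →
      t ≤ (T ∩ T').card := fun h1 h2 h3 h4 h5 =>
    le_card_inter_of_covers hk hs hrn hmax h1 h2 h3 h4 h5
  have h₀₁ : (T₀ ∩ T₁).card = t := by
    refine le_antisymm (Nat.lt_succ_iff.1 ?_) (hinter hT₀ hc₀ hcov₀ hT₁ hcov₁)
    rw [← Nat.add_one, ← hc₁]
    refine card_lt_card ⟨inter_subset_right, fun h => hne ?_⟩
    exact eq_of_subset_of_card_le (h.trans inter_subset_left) (by omega)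
  by_cases hstar : ∀ S, IsSigned S → S.card = t + 1 → (∀ F ∈ 𝓕, t ≤ (S ∩ F).card) → T₀ ∩ T₁ ⊆ S
  swap
  · push Not at hstar
    obtain ⟨T₂, hT₂, hc₂, hcov₂, hX⟩ := hstar
    exact Or.inl (eq_filter_of_three_covers hmax hT₀ hT₁ hT₂ hc₀ hc₁ hc₂ hcov₀ hcov₁ hcov₂ h₀₁
      (hinter hT₀ hc₀ hcov₀ hT₂ hcov₂) (hinter hT₁ hc₁ hcov₁ hT₂ hcov₂) hX)
  refine Or.inr ?_
  obtain ⟨X, Y, hX, hXY, hsig, hY, hcov, hout⟩ :=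
    exists_sunflower hmax hT₀ hT₁ hc₀ hc₁ hcov₀ hcov₁ h₀₁ hstar
  have hXE : X ⊆ X ∪ Y := subset_union_left
  have hE : (X ∪ Y).card = t + Y.card := by rw [card_union_of_disjoint hXY, hX]
  obtain ⟨F₂, hF₂, hXF₂⟩ := exists_not_subset_of_maximal hmax (hsig.mono hXE) hX
  have hs2 : 2 ≤ s := by
    by_contra h
    obtain rfl : s = 1 := by omega
    obtain ⟨h1, h2, h3⟩ := hself F₂ hF₂
    obtain ⟨y, -, hy⟩ := hcov F₂ h1 h2 h3
    exact hXF₂ (hy ▸ subset_insert _ _)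
  have hYs : Y.card ≤ s + 1 := by
    obtain ⟨hYF, x, hxX, hxF, hx⟩ := hout F₂ hF₂ hXF₂
    have h1 := card_le_card (inter_subset_left (s₁ := F₂) (s₂ := X ∪ Y))
    rw [inter_union_eq_erase hYF hxF hx, card_erase_of_mem (hXE hxX), hE,
      (hself F₂ hF₂).2.1] at h1
    omega
  rcases (show Y.card < s ∨ Y.card = s ∨ Y.card = s + 1 by omega) with hd | hd | hd
  · exfalso
    have hle := card_le_of_sunflower hrn h𝓕 hint hP hdec hX hXY hY hcov hF₂ hXF₂ hout
    obtain ⟨e, he⟩ : ∃ e, s = Y.card + e := ⟨s - Y.card, by omega⟩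
    have he1 : 1 ≤ e := by omega
    have h3 : 2 * ((s.choose 2 : ℤ) * b) = s * (s - 1) * b := by
      linear_combination (b : ℤ) * hchoose
    have hb : (0 : ℤ) < b := by exact_mod_cast hpos hs2
    have htz : (1 : ℤ) ≤ t := by exact_mod_cast ht
    have hez : (s : ℤ) = Y.card + e := by exact_mod_cast he
    rw [show s + 1 - Y.card = e + 1 by omega] at hle
    split_ifs at hle with hY2
    · have key := mul_lt_of_coeff_lt (by omega) hb
        (coeff_two_covers (s := s) (by omega) htz hPz) hq
      have hle' : (𝓕.card : ℤ) ≤ Y.card * a + (e + 1) * ((s + 1) * b) + t * ((s + 1) * b) := by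
        exact_mod_cast hle
      rw [show (e : ℤ) + 1 = s - 1 by omega, show (Y.card : ℤ) = 2 by omega] at hle'
      linarith
    · have key := mul_lt_of_coeff_lt (by omega) hb
        (coeff_many_covers (s := s) (e := e) (by omega) (by omega) htz hPz hQz) hq
      have hle' : (𝓕.card : ℤ) ≤ Y.card * a + (e + 1) * ((s + 1) * b) + t * (1 * b) := by
        exact_mod_cast hle
      rw [show (Y.card : ℤ) = s - e by omega] at hle'
      linarith
  · by_cases hin : ∀ F ∈ 𝓕, X ⊆ F → t + 1 ≤ (F ∩ (X ∪ Y)).card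
    · refine Or.inl ⟨hs2, X, X ∪ Y, hXE, hX, hsig, Or.inl (by omega), ?_⟩
      rw [hE]
      exact eq_familyOne_of_sunflower hmax hX hXY hY hout hin
    · push Not at hin
      obtain ⟨G, hG, hXG, hGE⟩ := hin
      obtain ⟨Z, hZ, hZs, hZ1, hZ2, h⟩ :=
        eq_familyTwo_of_sunflower hs2 hmax hX hXY hd hsig hcov hout hG hXG hGE
      exact Or.inr ⟨hs2, X, X ∪ Y, Z, hXE, hZ, hX, by omega, hZs, hZ1, hZ2, h⟩
  · refine Or.inl ⟨hs2, X, X ∪ Y, hXE, hX, hsig, Or.inr (by omega), ?_⟩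
    rw [hE]
    exact eq_familyOne_of_sunflower hmax hX hXY hY hout
      (le_card_inter_of_card_eq_add_one hmax hX hXY hd (hsig.mono hXE) hout)

end SignedSets

open SignedSets in
theorem theorem1 (n r k t : ℕ) (ht : 1 ≤ t) (hn : t + 2 ≤ n) (hr : t + 1 ≤ r) (hrn : r ≤ n)
    (hk : 2 ≤ k) (hg : SignedSets.g n r t ≤ (k : ℝ))
    (𝓕 : Finset (Finset (Fin n × Fin k)))
    (h𝓕 : Maximal (SignedSets.IsNontrivialTIntersecting n r k t) 𝓕) :
    SignedSets.f n r k r t ≤ (𝓕.card : ℤ) ↔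
      (t + 2 ≤ r ∧ ∃ m : ℕ, (m = r ∨ m = min (r + 1) n) ∧
        SignedSets.IsIsomorphic 𝓕 (SignedSets.H₁ n r k m t)) ∨
      (r + 2 ≤ n ∧ t + 4 ≤ r + 2 ∧ ∃ c : ℕ, r + 2 ≤ c ∧ c ≤ min (2 * r - t) n ∧
        SignedSets.IsIsomorphic 𝓕 (SignedSets.H₂ n r k c t)) ∨
      (r ≤ 2 * t + 2 ∧ r ≠ t + 2 ∧
        SignedSets.IsIsomorphic 𝓕 (SignedSets.H₁ n r k (t + 2) t)) := by
  obtain ⟨s, rfl⟩ : ∃ s, r = t + s := ⟨r - t, by omega⟩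
  have hs : 1 ≤ s := by omega
  have hk0 : 0 < k := by omega
  have hgn := le_of_g_le hn hs hg
  set m := max ((t + 1) * (t + 2)) (s + 1) with hm
  have hP : (t + 1) * (t + 2) ≤ m := le_max_left _ _
  have hQ : s + 1 ≤ m := le_max_right _ _
  have hdec : ∀ j, t + 1 ≤ j →
      (s + 3) * m * starCard n (t + s) k (j + 1) ≤ 2 * starCard n (t + s) k j :=
    fun j hj => starCard_decay hrn hgn hj
  have hq : ((s : ℤ) + 3) * m * starCard n (t + s) k (t + 2) ≤
      2 * starCard n (t + s) k (t + 1) := by exact_mod_cast hdec (t + 1) le_rfl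
  have hPz : ((t : ℤ) + 1) * (t + 2) ≤ m := by exact_mod_cast hP
  have hQz : (s : ℤ) + 1 ≤ m := by exact_mod_cast hQ
  have hchoose := two_mul_choose_two s
  constructor
  · intro hf
    rcases classification ht hs hrn hk hP hQ hdec h𝓕 hf with
      ⟨X, Z, hXZ, hX, hZ, hZs, heq⟩ | ⟨hs2, X, E, hXE, hX, hEs, hE, heq⟩ |
        ⟨hs2, X, E, Z, hXE, hEZ, hX, hE, hZs, hZ1, hZ2, heq⟩
    · have hiso : IsIsomorphic 𝓕 (H₁ n (t + s) k (t + 2) t) := by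
        rw [heq, ← familyOne_eq_filter hXZ hZ]
        exact isIsomorphic_familyOne hk0 hZs hXZ hX hZ
      by_cases hs2 : s = 2
      · subst hs2
        exact Or.inl ⟨le_rfl, t + 2, Or.inl rfl, hiso⟩
      · refine Or.inr (Or.inr ⟨?_, by omega, hiso⟩)
        by_contra hlt
        have hcount := card_filter_inter_add hrn hZs hZ
        rw [← heq] at hcount
        rw [f_eq hs] at hf
        have hb : (0 : ℤ) < starCard n (t + s) k (t + 2) := by
          exact_mod_cast starCard_pos hk0 (by omega) hrn
        have hcoeff : (s : ℤ) * (s - 1) - 2 * (t + 1) < (s - (t + 2)) * ((s + 3) * m) := by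
          have h1 : ((s : ℤ) + 3) * (s + 1) ≤ (s + 3) * m :=
            mul_le_mul_of_nonneg_left hQz (by omega)
          have h2 : (1 : ℤ) ≤ s - (t + 2) := by omega
          nlinarith
        have key := mul_lt_of_coeff_lt (by omega) hb hcoeff hq
        have h3 : 2 * ((s.choose 2 : ℤ) * starCard n (t + s) k (t + 2)) =
            s * (s - 1) * starCard n (t + s) k (t + 2) := by
          linear_combination (starCard n (t + s) k (t + 2) : ℤ) * hchoose
        zify at hcount
        linarith
    · refine Or.inl ⟨by omega, E.card, ?_, ?_⟩
      · have := hEs.card_le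
        omega
      · rw [heq]
        exact isIsomorphic_familyOne hk0 hEs hXE hX rfl
    · have := hZs.card_le
      refine Or.inr (Or.inl ⟨by omega, by omega, Z.card, by omega, by omega, ?_⟩)
      rw [heq]
      exact isIsomorphic_familyTwo hk0 hZs hXE hEZ hX hE rfl
  · rintro (⟨-, l, hl, hiso⟩ | ⟨-, -, c, -, -, hiso⟩ | ⟨hst, hne, hiso⟩)
    · rw [← hiso.card_eq]
      refine le_card_of_superset_meeting hs hk0 hrn fun F hF h1 h2 =>
        Finset.mem_filter.2 ⟨hF, Or.inl ⟨h1, h2.trans (Finset.card_le_card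
          (Finset.inter_subset_inter_left (M_mono ?_)))⟩⟩
      omega
    · rw [← hiso.card_eq]
      exact le_card_of_superset_meeting hs hk0 hrn fun F hF h1 h2 =>
        Finset.mem_filter.2 ⟨hF, Or.inl ⟨h1, h2⟩⟩
    · have hZ : (M n k (t + 2)).card = t + 2 := card_M hk0 hn
      have hcount := card_filter_inter_add hrn (isSigned_M (n := n) (k := k) (t + 2)) hZ
      rw [← familyOne_eq_filter (M_mono (show t ≤ t + 2 by omega)) hZ] at hcount
      rw [← hiso.card_eq, f_eq hs]
      change (_ : ℤ) ≤ ((familyOne n (t + s) k (t + 2) t (M n k t) (M n k (t + 2))).card : ℤ)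
      have hb : (0 : ℤ) ≤ starCard n (t + s) k (t + 2) := by positivity
      zify at hcount
      have h3 : 2 * ((s.choose 2 : ℤ) * starCard n (t + s) k (t + 2)) =
          s * (s - 1) * starCard n (t + s) k (t + 2) := by
        linear_combination (starCard n (t + s) k (t + 2) : ℤ) * hchoose
      have hcoeff : 2 * ((t : ℤ) + 1) - s * (s - 1) ≤ (t + 2 - s) * ((s + 3) * m) := by
        rcases (show s = t + 2 ∨ s < t + 2 by omega) with rfl | hlt
        · push_cast
          nlinarith
        · have h1 : (0 : ℤ) ≤ t + 1 - s := by omega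
          have h4 : 2 * ((t : ℤ) + 1) ≤ (s + 3) * m := by nlinarith
          have h5 : (0 : ℤ) ≤ s * (s - 1) := mul_nonneg (by omega) (by omega)
          nlinarith
      have h6 := mul_le_mul_of_nonneg_right hcoeff hb
      have h7 : ((t : ℤ) + 2 - s) * ((s + 3) * m * starCard n (t + s) k (t + 2)) ≤
          (t + 2 - s) * (2 * starCard n (t + s) k (t + 1)) :=
        mul_le_mul_of_nonneg_left hq (by omega)
      linarith
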